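/- **Theorem ($L^1$-contraction and comparison principle).** Let $N\ge 1$, $s\in(0,1]$. Let $b:\mathbb{R}\to\mathbb{R}$ be Lipschitz continuous and nondecreasing with $b(0)=0$ and $b(t)\,t\ge\lambda|t|^2$ for all $t\in\mathbb{R}$ and some $\lambda>0$, and let $F:\mathbb{R}\to\mathbb{R}^N$ be locally Lipschitz continuous with $F(0)=0$. For $f\in L^1(\mathbb{R}^N)\cap L^\infty(\mathbb{R}^N)$ consider the equation $$(\mathcal{P}_f)\qquad b(u)+\operatorname{div}F(u)+(-\Delta)^{s/2}u=f\quad\text{in }\mathbb{R}^N .$$ Put $C(N,s)=\dfrac{s\,\Gamma(\frac{N+s}{2})}{2\pi^{N/2+s}\,\Gamma(1-\frac s2)}$. A function $u\in L^\infty(\mathbb{R}^N)$ is called an *entropy solution* of $(\mathcal{P}_f)$ if for all $r>0$, all $\varphi\in C_c^\infty(\mathbb{R}^N)$ with $\varphi\ge 0$, all convex $\eta\in C^2(\mathbb{R})$ and all locally Lipschitz $\phi:\mathbb{R}\to\mathbb{R}^N$ with $\phi'=\eta'F'$ almost everywhere, $$\begin{aligned} &\int_{\mathbb{R}^N}(f(x)-b(u(x)))\,\eta'(u(x))\,\varphi(x)+\phi(u(x))\cdot\nabla\varphi(x)\,dx\\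 &+C(N,s)\int_{\mathbb{R}^N}\int_{\{|z|\ge r\}}\eta'(u(x))\,\frac{u(x+z)-u(x)}{|z|^{N+s}}\,\varphi(x)\,dz\,dx\\ &+C(N,s)\int_{\mathbb{R}^N}\int_{\{|z|\le r\}}\eta(u(x))\,\frac{\varphi(x+z)-\varphi(x)-\nabla\varphi(x)\cdot z}{|z|^{N+s}}\,dz\,dx\;\ge\;0 . \end{aligned}$$ Let $f,\tilde f\in L^1(\mathbb{R}^N)\cap L^\infty(\mathbb{R}^N)$, and let $u,\tilde u\in L^\infty(\mathbb{R}^N)$ be entropy solutions of $(\mathcal{P}_f)$ and $(\mathcal{P}_{\tilde f})$ respectively, such that $b(u),b(\tilde u)\in L^1(\mathbb{R}^N)$. Then $$\int_{\mathbb{R}^N}|b(u)-b(\tilde u)|\,dx\le\int_{\mathbb{R}^N}|f-\tilde f|\,dx ,$$ $$\int_{\mathbb{R}^N}(b(u)-b(\tilde u))^+dx\le\int_{\mathbb{R}^N}(f-\tilde f)^+dx,\qquad \int_{\mathbb{R}^N}(b(u)-b(\tilde u))^-dx\le\int_{\mathbb{R}^N}(f-\tilde f)^-dx ,$$ where $a^+=\max\{a,0\}$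 and $a^-=\max\{-a,0\}$. Moreover, if $f=\tilde f$ almost everywhere, then $b(u)=b(\tilde u)$ almost everywhere, and if in addition $b$ is strictly increasing, then $u=\tilde u$ almost everywhere. -/

import Mathlib

open MeasureTheory
open scoped ContDiff

noncomputable section

/-- The dimensional constant `C(N,s)` of the fractional Laplacian `(-Δ)^{s/2}` on `ℝ^N`,
normalised so that `(-Δ)^{s/2}` has Fourier symbol `|ξ|^s` for the Fourier transform with kernel
`exp (-2πi x·ξ)`. -/
def fracLapConst (N : ℕ) (s : ℝ) : ℝ :=
  s * Real.Gamma (((N : ℝ) + s) / 2) /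
    (2 * Real.pi ^ ((N : ℝ) / 2 + s) * Real.Gamma (1 - s / 2))

/-- `(η, Φ)` is an entropy-flux pair for the locally Lipschitz nonlinearity `F`: the entropy `η` is
convex and of class `C²`, and the flux `Φ` satisfies `Φ' = η' F'`. Since `F` is only locally
Lipschitz, its derivative exists almost everywhere, so that the relation means that `Φ` is locally
Lipschitz and that the equation holds almost everywhere. -/
structure IsEntropyFluxPair {N : ℕ} (F : ℝ → EuclideanSpace ℝ (Fin N)) (η : ℝ → ℝ)
    (Φ : ℝ → EuclideanSpace ℝ (Fin N)) : Prop where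
  contDiff : ContDiff ℝ 2 η
  convex : ConvexOn ℝ Set.univ η
  locallyLipschitz : LocallyLipschitz Φ
  hasDerivAt : ∀ᵐ t : ℝ, HasDerivAt Φ (deriv η t • deriv F t) t

/-- The left-hand side of the entropy inequality for the equation
`b(u) + div F(u) + (-Δ)^{s/2} u = f`, with entropy `η`, flux `Φ`, test function `φ` and
splitting radius `r`. Here `fderiv ℝ φ x v` is `∇φ(x) · v`. -/
def entropyForm {N : ℕ} (s : ℝ) (b : ℝ → ℝ) (f u : EuclideanSpace ℝ (Fin N) → ℝ)
    (η : ℝ → ℝ) (Φ : ℝ → EuclideanSpace ℝ (Fin N)) (φ : EuclideanSpace ℝ (Fin N) → ℝ)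
    (r : ℝ) : ℝ :=
  (∫ x, ((f x - b (u x)) * deriv η (u x) * φ x + fderiv ℝ φ x (Φ (u x))))
  + fracLapConst N s *
      (∫ x, ∫ z in {z : EuclideanSpace ℝ (Fin N) | r ≤ ‖z‖},
        deriv η (u x) * ((u (x + z) - u x) / ‖z‖ ^ ((N : ℝ) + s)) * φ x)
  + fracLapConst N s *
      (∫ x, ∫ z in {z : EuclideanSpace ℝ (Fin N) | ‖z‖ ≤ r},
        η (u x) * ((φ (x + z) - φ x - fderiv ℝ φ x z) / ‖z‖ ^ ((N : ℝ) + s)))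

/-- `u ∈ L^∞(ℝ^N)` is an entropy solution of `b(u) + div F(u) + (-Δ)^{s/2} u = f`. -/
structure IsEntropySolution {N : ℕ} (s : ℝ) (b : ℝ → ℝ) (F : ℝ → EuclideanSpace ℝ (Fin N))
    (f u : EuclideanSpace ℝ (Fin N) → ℝ) : Prop where
  memLp_top : MemLp u ⊤ volume
  entropy_ineq : ∀ r : ℝ, 0 < r →
    ∀ φ : EuclideanSpace ℝ (Fin N) → ℝ, ContDiff ℝ ∞ φ → HasCompactSupport φ → (∀ x, 0 ≤ φ x) →
    ∀ (η : ℝ → ℝ) (Φ : ℝ → EuclideanSpace ℝ (Fin N)), IsEntropyFluxPair F η Φ →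
      0 ≤ entropyForm s b f u η Φ φ r

end

open Filter Topology

/-! The proof is Kruzhkov's doubling of variables, run with one-sided entropies so that it compares
positive parts directly. Call the two solutions `u`, `v` and their data `f`, `f'`. The inequality
for `u` at `x` is tested with a smoothing of `(t - k)⁺` at level `k = v y`, the one for `v` at `y`
with a smoothing of `(k - t)⁺` at level `k = u x`, both against `φ x * J (x - y)` with `φ` a cutoff
and `J` a mollifier (`IsEntropySolution.kruzkov`). In the limit both entropy derivatives live on the
same set `{v y < u x}`, and in the sum (`exists_doubled_inequality`) the two terms containing the
gradient of `J` cancel. Jumps shorter than `r` cost at most a constant times the integral of `‖z‖²`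
against the kernel over `‖z‖ ≤ r`, which vanishes as `r → 0`.

The nonlocal terms are handled by convexity. With `A (x, y) = (u x - v y)⁺`, on `{v y < u x}` the
difference of the increments of `u` and `v` under a jump `z` is at most the increment of `A` along
`(z, z)`. Translation invariance moves this diagonal shift onto the test function; `J (x - y)` does
not see it, and averaging over `z` and `-z` leaves a second difference of `φ`
(`integral_truncatedOperator_doubled_le`).

What remains (`doubled_comparison`) is the wanted inequality, weighted by `φ x * J (x - y)`, up to
an error `(c / 2 * ∫ m * kernel + D * K) * (‖u‖₁ + ‖v‖₁)`. Here `m` bounds the second differences of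
`φ`, `D` its gradient, and `K` is a Lipschitz constant of `F` on the range of the solutions. The
growth of `b` gives `λ |t| ≤ |b t|`, so `u` and `v` are integrable. The error does not depend on
`J`: the mollifier is removed first at fixed `φ`, then `φ` is spread out to `1`, which sends `m` and
`D` to zero. Exchanging the solutions gives the negative part, and the sum gives the contraction and
uniqueness. -/

/-- The kernel `‖z‖^{-(N+s)}` of the fractional Laplacian of order `s` on `ℝ^N`. -/
noncomputable def levyKernel (N : ℕ) (s : ℝ) (z : EuclideanSpace ℝ (Fin N)) : ℝ :=
  (‖z‖ ^ ((N : ℝ) + s))⁻¹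

/-! ### Integrability of the Lévy kernel. -/

section Kernel

variable {N : ℕ} {s : ℝ}

lemma levyKernel_nonneg (z : EuclideanSpace ℝ (Fin N)) : 0 ≤ levyKernel N s z := by
  unfold levyKernel; positivity

lemma levyKernel_neg (z : EuclideanSpace ℝ (Fin N)) :
    levyKernel N s (-z) = levyKernel N s z := by
  simp [levyKernel]

lemma measurable_levyKernel : Measurable (levyKernel N s) := by
  unfold levyKernel; fun_prop

/-- In polar coordinates the radial density is `y ^ (1 - s)` near zero and `y ^ (-1 - s)` at
infinity, both integrable when `0 < s < 2`. -/
lemma integrable_min_one_sq_mul_levyKernel (hN : 1 ≤ N) (hs0 : 0 < s) (hs2 : s < 2) :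
    Integrable (fun z => min 1 (‖z‖ ^ 2) * levyKernel N s z) := by
  have : Nonempty (Fin N) := ⟨⟨0, hN⟩⟩
  have key := (integrable_fun_norm_addHaar
    (volume : Measure (EuclideanSpace ℝ (Fin N)))
    (f := fun y : ℝ => min 1 (y ^ 2) * (y ^ ((N : ℝ) + s))⁻¹)).2
  refine key ?_
  rw [finrank_euclideanSpace, Fintype.card_fin]
  have hmeas : Measurable fun y : ℝ => y ^ (N - 1) • (min 1 (y ^ 2) * (y ^ ((N : ℝ) + s))⁻¹) := by
    fun_prop
  have hpow : ∀ y : ℝ, 0 < y → y ^ (N - 1) * (y ^ ((N : ℝ) + s))⁻¹ = y ^ (-1 - s) := by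
    intro y hy
    rw [← Real.rpow_natCast, ← Real.rpow_neg hy.le, ← Real.rpow_add hy]
    congr 1
    push_cast [hN]
    ring
  rw [← Set.Ioc_union_Ioi_eq_Ioi (zero_le_one' ℝ)]
  refine IntegrableOn.union ?_ ?_
  · have h1 : IntegrableOn (fun y : ℝ => y ^ (1 - s)) (Set.Ioc 0 1) := by
      rw [← intervalIntegrable_iff_integrableOn_Ioc_of_le zero_le_one]
      exact intervalIntegral.intervalIntegrable_rpow' (by linarith)
    refine h1.mono' hmeas.aestronglyMeasurable ?_
    filter_upwards [ae_restrict_mem measurableSet_Ioc] with y hy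
    have hy0 := hy.1
    rw [Real.norm_of_nonneg (by positivity), smul_eq_mul]
    calc y ^ (N - 1) * (min 1 (y ^ 2) * (y ^ ((N : ℝ) + s))⁻¹)
        = min 1 (y ^ 2) * (y ^ (N - 1) * (y ^ ((N : ℝ) + s))⁻¹) := by ring
      _ ≤ y ^ 2 * y ^ (-1 - s) := by
          rw [hpow y hy0]
          gcongr
          exact min_le_right _ _
      _ = y ^ (1 - s) := by
          rw [← Real.rpow_natCast, ← Real.rpow_add hy0]
          congr 1
          push_cast
          ring
  · have h1 : IntegrableOn (fun y : ℝ => y ^ (-1 - s)) (Set.Ioi 1) :=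
      integrableOn_Ioi_rpow_of_lt (by linarith) one_pos
    refine h1.mono' hmeas.aestronglyMeasurable ?_
    filter_upwards [ae_restrict_mem measurableSet_Ioi] with y hy
    have hy0 : 0 < y := one_pos.trans hy
    rw [Real.norm_of_nonneg (by positivity), smul_eq_mul]
    calc y ^ (N - 1) * (min 1 (y ^ 2) * (y ^ ((N : ℝ) + s))⁻¹)
        = min 1 (y ^ 2) * (y ^ (N - 1) * (y ^ ((N : ℝ) + s))⁻¹) := by ring
      _ ≤ 1 * y ^ (-1 - s) := by
          rw [hpow y hy0]
          gcongr
          exact min_le_left _ _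
      _ = y ^ (-1 - s) := one_mul _

lemma integrableOn_levyKernel (hN : 1 ≤ N) (hs0 : 0 < s) (hs2 : s < 2) {r : ℝ} (hr : 0 < r) :
    IntegrableOn (levyKernel N s) {z | r ≤ ‖z‖} := by
  have h := ((integrable_min_one_sq_mul_levyKernel hN hs0 hs2).const_mul
    (min 1 (r ^ 2))⁻¹).integrableOn (s := {z | r ≤ ‖z‖})
  refine h.mono' measurable_levyKernel.aestronglyMeasurable ?_
  filter_upwards [ae_restrict_mem (measurableSet_le measurable_const measurable_norm)] with z hz
  have hz : r ≤ ‖z‖ := hz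
  rw [Real.norm_of_nonneg (levyKernel_nonneg z), ← mul_assoc]
  refine le_mul_of_one_le_left (levyKernel_nonneg z) ?_
  rw [← div_eq_inv_mul, one_le_div (by positivity)]
  gcongr

lemma integrableOn_sq_mul_levyKernel (hN : 1 ≤ N) (hs0 : 0 < s) (hs2 : s < 2) {r : ℝ}
    (hr : r ≤ 1) :
    IntegrableOn (fun z => ‖z‖ ^ 2 * levyKernel N s z) {z | ‖z‖ ≤ r} := by
  have h := (integrable_min_one_sq_mul_levyKernel hN hs0 hs2).integrableOn (s := {z | ‖z‖ ≤ r})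
  refine h.congr ?_
  filter_upwards [ae_restrict_mem (measurableSet_le measurable_norm measurable_const)] with z hz
  have hz : ‖z‖ ≤ r := hz
  rw [min_eq_right]
  nlinarith [norm_nonneg z]

lemma tendsto_setIntegral_sq_mul_levyKernel (hN : 1 ≤ N) (hs0 : 0 < s) (hs2 : s < 2) :
    Tendsto (fun n : ℕ => ∫ z in {z | ‖z‖ ≤ 1 / ((n : ℝ) + 1)}, ‖z‖ ^ 2 * levyKernel N s z)
      atTop (𝓝 0) := by
  have h := tendsto_setIntegral_of_antitone (μ := (volume : Measure (EuclideanSpace ℝ (Fin N))))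
    (s := fun n : ℕ => {z : EuclideanSpace ℝ (Fin N) | ‖z‖ ≤ 1 / ((n : ℝ) + 1)})
    (f := fun z => ‖z‖ ^ 2 * levyKernel N s z)
    (fun n => measurableSet_le measurable_norm measurable_const)
    (fun m n hmn z hz => le_trans (Set.mem_ofPred.1 hz) (Nat.one_div_le_one_div hmn))
    ⟨0, integrableOn_sq_mul_levyKernel hN hs0 hs2 (by simp)⟩
  convert h using 2
  symm
  refine setIntegral_eq_zero_of_forall_eq_zero fun z hz => ?_
  -- The balls shrink to the origin, where the factor `‖z‖ ^ 2` vanishes.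
  have : ‖z‖ ≤ 0 := ge_of_tendsto' tendsto_one_div_add_atTop_nhds_zero_nat
    (fun n => Set.mem_iInter.1 hz n)
  simp [le_antisymm this (norm_nonneg z)]

end Kernel

/-- A second order Taylor bound, uniform in the base point. -/
lemma exists_taylor_bound {V : Type*} [NormedAddCommGroup V] [NormedSpace ℝ V] {g : V → ℝ}
    (hg : ContDiff ℝ ∞ g) (hc : HasCompactSupport g) :
    ∃ B : ℝ, 0 ≤ B ∧ ∀ x z, |g (x + z) - g x - fderiv ℝ g x z| ≤ B * ‖z‖ ^ 2 := by
  obtain ⟨K, hK⟩ : ∃ K, LipschitzWith K (fderiv ℝ g) :=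
    ContDiff.lipschitzWith_of_hasCompactSupport (n := ∞) (hc.fderiv ℝ)
      (hg.fderiv_right (m := ∞) (by simp)) (by simp)
  refine ⟨K, K.2, fun x z => ?_⟩
  have h := (convex_closedBall x ‖z‖).norm_image_sub_le_of_norm_hasFDerivWithin_le'
    (f := g) (f' := fun y => fderiv ℝ g y) (φ := fderiv ℝ g x) (C := K * ‖z‖) (x := x) (y := x + z)
    (fun y _ => ((hg.differentiable (by simp)) y).hasFDerivAt.hasFDerivWithinAt)
    (fun y hy => by
      rw [← dist_eq_norm]
      refine (hK.dist_le_mul y x).trans ?_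
      gcongr
      exact hy)
    (by simp) (by simp)
  rw [← Real.norm_eq_abs]
  simpa [pow_two, mul_assoc] using h

/-! ### Entropy-flux pairs built from a monotone `C¹` function. -/

section Entropy

variable {N : ℕ} {F : ℝ → EuclideanSpace ℝ (Fin N)}

/-- A Lipschitz bound on each compact interval gives locally bounded variation, hence
differentiability almost everywhere. -/
lemma LocallyLipschitz.ae_differentiableAt_real {G : ℝ → EuclideanSpace ℝ (Fin N)}
    (hG : LocallyLipschitz G) : ∀ᵐ t, DifferentiableAt ℝ G t := by
  have h : LocallyBoundedVariationOn G Set.univ := by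
    intro a c _ _
    obtain ⟨K, hK⟩ := hG.locallyLipschitzOn.exists_lipschitzOnWith_of_compact
      (s := Set.Icc a c) isCompact_Icc
    rcases le_or_gt a c with hac | hac
    · simpa using hK.locallyBoundedVariationOn a c (by simp [hac]) (by simp [hac])
    · simp [Set.Icc_eq_empty_of_lt hac, BoundedVariationOn]
  exact h.ae_differentiableAt

/-- The entropy with derivative `χ`, normalised at `k`. -/
noncomputable def entropyOf (χ : ℝ → ℝ) (k t : ℝ) : ℝ := ∫ τ in k..t, χ τ

/-- The flux with derivative `χ F'`, normalised at `k` and written after an integration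
by parts. -/
noncomputable def fluxOf (F : ℝ → EuclideanSpace ℝ (Fin N)) (χ : ℝ → ℝ) (k t : ℝ) :
    EuclideanSpace ℝ (Fin N) :=
  χ t • (F t - F k) - ∫ τ in k..t, deriv χ τ • (F τ - F k)

lemma hasDerivAt_entropyOf {χ : ℝ → ℝ} (hχ : Continuous χ) (k t : ℝ) :
    HasDerivAt (entropyOf χ k) (χ t) t :=
  intervalIntegral.integral_hasDerivAt_right (hχ.intervalIntegrable _ _)
    (hχ.stronglyMeasurableAtFilter _ _) hχ.continuousAt

lemma deriv_entropyOf {χ : ℝ → ℝ} (hχ : Continuous χ) (k : ℝ) : deriv (entropyOf χ k) = χ :=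
  funext fun t => (hasDerivAt_entropyOf hχ k t).deriv

/-- Wherever `F` is differentiable, the two occurrences of `χ' (F - F k)` in the derivative of the
flux cancel and `χ F'` is left. Since the flux is written without `F'`, its integrand is continuous
and the integral is `C¹`. -/
lemma isEntropyFluxPair_entropyOf_fluxOf (hF : LocallyLipschitz F) {χ : ℝ → ℝ}
    (hχ : ContDiff ℝ 1 χ) (hmono : Monotone χ) (k : ℝ) :
    IsEntropyFluxPair F (entropyOf χ k) (fluxOf F χ k) := by
  have hd : Differentiable ℝ (entropyOf χ k) := fun t =>
    (hasDerivAt_entropyOf hχ.continuous k t).differentiableAt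
  have hc : Continuous fun τ => deriv χ τ • (F τ - F k) :=
    (hχ.continuous_deriv le_rfl).smul (hF.continuous.sub continuous_const)
  have hint : ∀ t, HasDerivAt (fun t => ∫ τ in k..t, deriv χ τ • (F τ - F k))
      (deriv χ t • (F t - F k)) t := fun t =>
    intervalIntegral.integral_hasDerivAt_right (hc.intervalIntegrable _ _)
      (hc.stronglyMeasurableAtFilter _ _) hc.continuousAt
  refine ⟨?_, ?_, ?_, ?_⟩
  · rw [show (2 : WithTop ℕ∞) = 1 + 1 by norm_num, contDiff_succ_iff_deriv]
    refine ⟨hd, by simp, ?_⟩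
    rwa [deriv_entropyOf hχ.continuous]
  · refine Monotone.convexOn_univ_of_deriv hd ?_
    rwa [deriv_entropyOf hχ.continuous]
  · have h1 : LocallyLipschitz χ := hχ.locallyLipschitz
    have h2 : LocallyLipschitz fun t => ∫ τ in k..t, deriv χ τ • (F τ - F k) := by
      refine ContDiff.locallyLipschitz (𝕂 := ℝ)
        (contDiff_one_iff_deriv.2 ⟨fun t => (hint t).differentiableAt, ?_⟩)
      rwa [show deriv (fun t => ∫ τ in k..t, deriv χ τ • (F τ - F k)) = _ from
        funext fun t => (hint t).deriv]
    have h3 : LocallyLipschitz fun p : ℝ × EuclideanSpace ℝ (Fin N) => p.1 • p.2 :=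
      (contDiff_smul (𝕜 := ℝ) (n := 1)).locallyLipschitz
    have h4 : LocallyLipschitz fun t => F t - F k :=
      hF.sub (LocallyLipschitz.const _)
    exact (h3.comp (h1.prodMk h4)).sub h2
  · filter_upwards [hF.ae_differentiableAt_real] with t ht
    rw [deriv_entropyOf hχ.continuous]
    have h1 := ((hχ.differentiable (by simp) t).hasDerivAt.smul
      (ht.hasDerivAt.sub_const (F k))).sub (hint t)
    exact h1.congr_deriv (add_sub_cancel_right _ _)

end Entropy

/-! ### Smooth approximation of the one-sided sign functions. -/

section Flux

variable {N : ℕ} {F : ℝ → EuclideanSpace ℝ (Fin N)}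

/-- A `C¹` sequence approximating a sign-type function that jumps at `k`. -/
structure IsSignApprox (k : ℝ) (χ : ℕ → ℝ → ℝ) (χ' : ℝ → ℝ) : Prop where
  contDiff : ∀ n, ContDiff ℝ 1 (χ n)
  monotone : ∀ n, Monotone (χ n)
  abs_le_one : ∀ n t, |χ n t| ≤ 1
  tendsto : ∀ t, Tendsto (fun n => χ n t) atTop (𝓝 (χ' t))
  deriv_eq_zero : ∀ (n : ℕ) t, 1 / ((n : ℝ) + 1) < |t - k| → deriv (χ n) t = 0

lemma tendsto_smoothTransition_nat_mul (t : ℝ) :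
    Tendsto (fun n : ℕ => Real.smoothTransition (((n : ℝ) + 1) * t)) atTop
      (𝓝 (if 0 < t then 1 else 0)) := by
  split_ifs with h
  · refine tendsto_const_nhds.congr' ?_
    obtain ⟨m, hm⟩ := exists_nat_gt (1 / t)
    filter_upwards [eventually_ge_atTop m] with n hn
    rw [Real.smoothTransition.one_of_one_le]
    rw [div_lt_iff₀ h] at hm
    have : (m : ℝ) ≤ n := by exact_mod_cast hn
    nlinarith
  · refine tendsto_const_nhds.congr fun n => ?_
    rw [Real.smoothTransition.zero_of_nonpos]
    exact mul_nonpos_of_nonneg_of_nonpos (by positivity) (not_lt.1 h)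

lemma deriv_smoothTransition_eq_zero {t : ℝ} (ht : t < 0 ∨ 1 < t) :
    deriv Real.smoothTransition t = 0 := by
  rcases ht with ht | ht
  · have : Real.smoothTransition =ᶠ[𝓝 t] fun _ => 0 := by
      filter_upwards [Iio_mem_nhds ht] with y hy
      exact Real.smoothTransition.zero_of_nonpos (le_of_lt hy)
    rw [this.deriv_eq, deriv_const]
  · have : Real.smoothTransition =ᶠ[𝓝 t] fun _ => 1 := by
      filter_upwards [Ioi_mem_nhds ht] with y hy
      exact Real.smoothTransition.one_of_one_le (le_of_lt hy)
    rw [this.deriv_eq, deriv_const]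

/-- The transition starts at `k` instead of being centred there, so the limit is `0` at `k` itself
and is the strict indicator. -/
lemma isSignApprox_pos (k : ℝ) :
    IsSignApprox k (fun n t => Real.smoothTransition (((n : ℝ) + 1) * (t - k)))
      (fun t => if k < t then 1 else 0) where
  contDiff n := Real.smoothTransition.contDiff.comp (by fun_prop)
  monotone n := Real.smoothTransition.monotone.comp fun x y h => by
    gcongr
  abs_le_one n t := by
    rw [abs_of_nonneg (Real.smoothTransition.nonneg _)]
    exact Real.smoothTransition.le_one _
  tendsto t := by simpa using tendsto_smoothTransition_nat_mul (t - k)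
  deriv_eq_zero n t ht := by
    have hd : HasDerivAt (fun t : ℝ => ((n : ℝ) + 1) * (t - k)) (((n : ℝ) + 1) * 1) t :=
      ((hasDerivAt_id t).sub_const k).const_mul _
    have hS : DifferentiableAt ℝ Real.smoothTransition (((n : ℝ) + 1) * (t - k)) :=
      (Real.smoothTransition.contDiffAt (n := 1)).differentiableAt (by simp)
    have h := (hS.hasDerivAt.comp t hd).deriv
    refine h.trans ?_
    rw [deriv_smoothTransition_eq_zero, zero_mul]
    have hn : (0 : ℝ) < (n : ℝ) + 1 := by positivity
    rw [div_lt_iff₀ hn] at ht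
    rcases le_total 0 (t - k) with h0 | h0
    · rw [abs_of_nonneg h0] at ht
      right; linarith
    · rw [abs_of_nonpos h0] at ht
      left; nlinarith

/-- Mirror image of `isSignApprox_pos`: with `k = u x` and `t = v y` the limit is nonzero exactly on
`{v y < u x}`, the same set as for `k = v y` and `t = u x` there. -/
lemma isSignApprox_neg (k : ℝ) :
    IsSignApprox k (fun n t => -Real.smoothTransition (((n : ℝ) + 1) * (k - t)))
      (fun t => if t < k then -1 else 0) where
  contDiff n := (Real.smoothTransition.contDiff.comp (by fun_prop)).neg
  monotone n x y h := by
    refine neg_le_neg (Real.smoothTransition.monotone ?_)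
    gcongr
  abs_le_one n t := by
    rw [abs_neg, abs_of_nonneg (Real.smoothTransition.nonneg _)]
    exact Real.smoothTransition.le_one _
  tendsto t := by
    convert (tendsto_smoothTransition_nat_mul (k - t)).neg using 2
    simp only [sub_pos]
    split_ifs <;> simp
  deriv_eq_zero n t ht := by
    have hd : HasDerivAt (fun t : ℝ => ((n : ℝ) + 1) * (k - t)) (((n : ℝ) + 1) * (-1)) t :=
      ((hasDerivAt_id t).const_sub k).const_mul _
    have hS : DifferentiableAt ℝ Real.smoothTransition (((n : ℝ) + 1) * (k - t)) :=
      (Real.smoothTransition.contDiffAt (n := 1)).differentiableAt (by simp)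
    have h := (hS.hasDerivAt.comp t hd).neg.deriv
    refine h.trans ?_
    rw [deriv_smoothTransition_eq_zero, zero_mul, neg_zero]
    have hn : (0 : ℝ) < (n : ℝ) + 1 := by positivity
    rw [div_lt_iff₀ hn] at ht
    rcases le_total 0 (t - k) with h0 | h0
    · rw [abs_of_nonneg h0] at ht
      left; nlinarith
    · rw [abs_of_nonpos h0] at ht
      right; linarith

/-- The derivative of `χ n` has mass at most `2` between `k` and `t` and lives within `1 / (n + 1)`
of `k`, where `F` differs from `F k` by at most `K / (n + 1)`. -/
lemma IsSignApprox.norm_fluxOf_sub_le {k : ℝ} {χ : ℕ → ℝ → ℝ} {χ' : ℝ → ℝ}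
    (h : IsSignApprox k χ χ') {K : NNReal} {M : ℝ}
    (hK : LipschitzOnWith K F (Set.Icc (-M) M)) (hk : |k| ≤ M) (n : ℕ) {t : ℝ} (ht : |t| ≤ M) :
    ‖fluxOf F (χ n) k t - χ n t • (F t - F k)‖ ≤ 2 * (K * (1 / ((n : ℝ) + 1))) := by
  have hd : Continuous (deriv (χ n)) := (h.contDiff n).continuous_deriv le_rfl
  have hsub : Set.uIoc k t ⊆ Set.Icc (-M) M := Set.uIoc_subset_uIcc.trans
    (Set.OrdConnected.uIcc_subset Set.ordConnected_Icc (abs_le.1 hk) (abs_le.1 ht))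
  have hb := intervalIntegral.norm_integral_le_abs_of_norm_le (μ := volume) (a := k) (b := t)
    (f := fun τ => deriv (χ n) τ • (F τ - F k))
    (g := fun τ => deriv (χ n) τ * (K * (1 / ((n : ℝ) + 1))))
    (by
      filter_upwards [ae_restrict_mem measurableSet_uIoc] with τ hτ
      rw [norm_smul, Real.norm_of_nonneg ((h.monotone n).deriv_nonneg)]
      rcases lt_or_ge (1 / ((n : ℝ) + 1)) |τ - k| with h1 | h1
      · rw [h.deriv_eq_zero n τ h1, zero_mul, zero_mul]
      · refine mul_le_mul_of_nonneg_left ?_ ((h.monotone n).deriv_nonneg)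
        rw [← dist_eq_norm]
        refine (hK.dist_le_mul τ (hsub hτ) k (abs_le.1 hk)).trans ?_
        gcongr
        exact h1)
    ((hd.mul continuous_const).intervalIntegrable _ _)
  rw [intervalIntegral.integral_mul_const, intervalIntegral.integral_deriv_eq_sub'
    (χ n) rfl (fun x _ => ((h.contDiff n).differentiable one_ne_zero) x) hd.continuousOn] at hb
  rw [fluxOf, sub_sub_cancel_left, norm_neg]
  refine hb.trans ?_
  rw [abs_mul, abs_of_nonneg (a := (K : ℝ) * _) (by positivity)]
  gcongr
  calc |χ n t - χ n k| ≤ |χ n t| + |χ n k| := abs_sub _ _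
    _ ≤ 2 := by linarith [h.abs_le_one n t, h.abs_le_one n k]

lemma abs_entropyOf_le {χ : ℝ → ℝ} (h : ∀ t, |χ t| ≤ 1) (k t : ℝ) :
    |entropyOf χ k t| ≤ |t - k| := by
  simpa [entropyOf] using intervalIntegral.norm_integral_le_of_norm_le_const
    (a := k) (b := t) (f := χ) (C := 1) (fun x _ => h x)

end Flux

/-! ### Passage to bounded Borel representatives. -/

section Representatives

variable {N : ℕ} {s : ℝ} {b : ℝ → ℝ} {F : ℝ → EuclideanSpace ℝ (Fin N)}

/-- Translations preserve null sets, so the inner integrals also see only almost everywhere classes.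
This allows bounded Borel representatives, for which every value `v y` is an admissible Kruzhkov
level. -/
lemma entropyForm_congr_ae {f f' u u' : EuclideanSpace ℝ (Fin N) → ℝ} (hf : f =ᵐ[volume] f')
    (hu : u =ᵐ[volume] u') (η : ℝ → ℝ) (Φ : ℝ → EuclideanSpace ℝ (Fin N))
    (φ : EuclideanSpace ℝ (Fin N) → ℝ) (r : ℝ) :
    entropyForm s b f u η Φ φ r = entropyForm s b f' u' η Φ φ r := by
  unfold entropyForm
  congr 1
  · congr 1
    · refine integral_congr_ae ?_
      filter_upwards [hf, hu] with x h1 h2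
      rw [h1, h2]
    · congr 1
      refine integral_congr_ae ?_
      filter_upwards [hu] with x hx
      refine integral_congr_ae (ae_restrict_of_ae ?_)
      have : ∀ᵐ z, u (x + z) = u' (x + z) :=
        (measurePreserving_add_left volume x).quasiMeasurePreserving.ae hu
      filter_upwards [this] with z hz
      rw [hx, hz]
  · congr 1
    refine integral_congr_ae ?_
    filter_upwards [hu] with x hx
    rw [hx]

lemma IsEntropySolution.congr_ae {f f' u u' : EuclideanSpace ℝ (Fin N) → ℝ}
    (h : IsEntropySolution s b F f u) (hf : f =ᵐ[volume] f') (hu : u =ᵐ[volume] u') :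
    IsEntropySolution s b F f' u' where
  memLp_top := (memLp_congr_ae hu).1 h.memLp_top
  entropy_ineq r hr φ h1 h2 h3 η Φ h4 := by
    rw [← entropyForm_congr_ae hf hu]
    exact h.entropy_ineq r hr φ h1 h2 h3 η Φ h4

lemma exists_measurable_bounded_representative {u : EuclideanSpace ℝ (Fin N) → ℝ}
    (hu : MemLp u ⊤ volume) :
    ∃ v : EuclideanSpace ℝ (Fin N) → ℝ, Measurable v ∧ (∃ M, ∀ x, |v x| ≤ M) ∧
      u =ᵐ[volume] v := by
  set M := (eLpNorm u ⊤ volume).toReal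
  have hM : ∀ᵐ x, |u x| ≤ M := by
    have hfin : eLpNorm u ⊤ volume ≠ ⊤ := hu.2.ne
    rw [eLpNorm_exponent_top] at hfin
    filter_upwards [ae_le_eLpNormEssSup (f := u) (μ := volume)] with x hx
    have := ENNReal.toReal_mono hfin hx
    simpa [M] using this
  refine ⟨fun x => max (-M) (min M (hu.1.mk u x)), ?_, ⟨M, fun x => ?_⟩, ?_⟩
  · exact measurable_const.max (measurable_const.min hu.1.stronglyMeasurable_mk.measurable)
  · have : 0 ≤ M := ENNReal.toReal_nonneg
    exact abs_le.2 ⟨le_max_left _ _, max_le (by linarith) (min_le_left _ _)⟩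
  · filter_upwards [hM, hu.1.ae_eq_mk] with x h1 h2
    rw [← h2, min_eq_right (abs_le.1 h1).2, max_eq_right (abs_le.1 h1).1]

end Representatives

/-! ### Kruzhkov inequalities with truncated nonlocal operator. -/

lemma fracLapConst_nonneg {N : ℕ} {s : ℝ} (hs0 : 0 < s) (hs1 : s ≤ 1) :
    0 ≤ fracLapConst N s := by
  have h1 : 0 < Real.Gamma (((N : ℝ) + s) / 2) := Real.Gamma_pos_of_pos (by positivity)
  have h2 : 0 < Real.Gamma (1 - s / 2) := Real.Gamma_pos_of_pos (by linarith)
  unfold fracLapConst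
  positivity

/-- The part of the nonlocal operator coming from increments of length at least `r`. -/
noncomputable def truncatedOperator {N : ℕ} (s r : ℝ) (u : EuclideanSpace ℝ (Fin N) → ℝ)
    (x : EuclideanSpace ℝ (Fin N)) : ℝ :=
  ∫ z in {z | r ≤ ‖z‖}, (u (x + z) - u x) * levyKernel N s z

section Kruzkov

variable {N : ℕ} {s : ℝ} {b : ℝ → ℝ} {F : ℝ → EuclideanSpace ℝ (Fin N)}

lemma measurable_truncatedOperator {u : EuclideanSpace ℝ (Fin N) → ℝ} (hu : Measurable u)
    (r : ℝ) : Measurable (truncatedOperator s r u) := by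
  have h : StronglyMeasurable fun p : EuclideanSpace ℝ (Fin N) × EuclideanSpace ℝ (Fin N) =>
      (u (p.1 + p.2) - u p.1) * levyKernel N s p.2 := by
    refine Measurable.stronglyMeasurable ?_
    have := measurable_levyKernel (N := N) (s := s)
    fun_prop
  exact h.integral_prod_right.measurable

lemma abs_truncatedOperator_le (hN : 1 ≤ N) (hs0 : 0 < s) (hs2 : s < 2) {r : ℝ} (hr : 0 < r)
    {u : EuclideanSpace ℝ (Fin N) → ℝ} {M : ℝ} (hM : ∀ x, |u x| ≤ M)
    (x : EuclideanSpace ℝ (Fin N)) :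
    |truncatedOperator s r u x| ≤ ∫ z in {z | r ≤ ‖z‖}, 2 * M * levyKernel N s z := by
  rw [← Real.norm_eq_abs, truncatedOperator]
  refine norm_integral_le_of_norm_le ((integrableOn_levyKernel hN hs0 hs2 hr).const_mul _)
    (Eventually.of_forall fun z => ?_)
  rw [norm_mul, Real.norm_of_nonneg (levyKernel_nonneg z)]
  refine mul_le_mul_of_nonneg_right ?_ (levyKernel_nonneg z)
  calc ‖u (x + z) - u x‖ ≤ |u (x + z)| + |u x| := abs_sub _ _
    _ ≤ 2 * M := by linarith [hM (x + z), hM x]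

lemma fderiv_eq_zero_of_norm_gt {φ : EuclideanSpace ℝ (Fin N) → ℝ} {ρ : ℝ}
    (hρ : ∀ x, ρ < ‖x‖ → φ x = 0) {x : EuclideanSpace ℝ (Fin N)} (hx : ρ < ‖x‖) :
    fderiv ℝ φ x = 0 := by
  have : φ =ᶠ[𝓝 x] fun _ => 0 := by
    filter_upwards [(isOpen_lt continuous_const continuous_norm).mem_nhds hx] with y hy
    exact hρ y hy
  rw [this.fderiv_eq]
  simp

/-- The singular part of the nonlocal term of the entropy inequality is small. -/
lemma abs_singularTerm_le (hN : 1 ≤ N) (hs0 : 0 < s) (hs2 : s < 2) {r : ℝ} (hr1 : r ≤ 1)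
    {φ : EuclideanSpace ℝ (Fin N) → ℝ} {ρ B : ℝ}
    (hρ : ∀ x, ρ < ‖x‖ → φ x = 0)
    (hB : ∀ x z, |φ (x + z) - φ x - fderiv ℝ φ x z| ≤ B * ‖z‖ ^ 2)
    {g : EuclideanSpace ℝ (Fin N) → ℝ} {M : ℝ} (hg : ∀ x, |g x| ≤ M) :
    |∫ x, ∫ z in {z : EuclideanSpace ℝ (Fin N) | ‖z‖ ≤ r},
        g x * ((φ (x + z) - φ x - fderiv ℝ φ x z) / ‖z‖ ^ ((N : ℝ) + s))| ≤
      M * B * (∫ z in {z : EuclideanSpace ℝ (Fin N) | ‖z‖ ≤ r}, ‖z‖ ^ 2 * levyKernel N s z) *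
        volume.real (Metric.closedBall (0 : EuclideanSpace ℝ (Fin N)) (ρ + 1)) := by
  have hM0 : 0 ≤ M := (abs_nonneg _).trans (hg 0)
  set W := ∫ z in {z : EuclideanSpace ℝ (Fin N) | ‖z‖ ≤ r}, ‖z‖ ^ 2 * levyKernel N s z with hW
  have hW0 : 0 ≤ W := integral_nonneg fun z => mul_nonneg (by positivity) (levyKernel_nonneg z)
  have hball : MeasurableSet (Metric.closedBall (0 : EuclideanSpace ℝ (Fin N)) (ρ + 1)) :=
    Metric.isClosed_closedBall.measurableSet
  have hint : Integrable ((Metric.closedBall (0 : EuclideanSpace ℝ (Fin N)) (ρ + 1)).indicator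
      fun _ => M * B * W) :=
    (integrable_indicator_iff hball).2
      (integrableOn_const (isCompact_closedBall _ _).measure_lt_top.ne)
  have h := norm_integral_le_of_norm_le (μ := volume)
    (f := fun x => ∫ z in {z : EuclideanSpace ℝ (Fin N) | ‖z‖ ≤ r},
        g x * ((φ (x + z) - φ x - fderiv ℝ φ x z) / ‖z‖ ^ ((N : ℝ) + s)))
    hint (Eventually.of_forall fun x => ?_)
  · rw [integral_indicator hball, setIntegral_const, smul_eq_mul] at h
    rw [mul_comm (M * B * W)]
    exact h
  · by_cases hx : x ∈ Metric.closedBall (0 : EuclideanSpace ℝ (Fin N)) (ρ + 1)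
    · rw [Set.indicator_of_mem hx, hW, ← integral_const_mul]
      refine norm_integral_le_of_norm_le
        ((integrableOn_sq_mul_levyKernel hN hs0 hs2 hr1).const_mul _)
        (Eventually.of_forall fun z => ?_)
      rw [div_eq_mul_inv, ← levyKernel, norm_mul, norm_mul,
        Real.norm_of_nonneg (levyKernel_nonneg (s := s) z)]
      have h1 := mul_le_mul (hg x) (hB x z) (abs_nonneg _) hM0
      have h2 := mul_le_mul_of_nonneg_right h1 (levyKernel_nonneg (s := s) z)
      simp only [Real.norm_eq_abs] at h2 ⊢
      linarith
    -- As `r ≤ 1`, a jump from outside radius `ρ + 1` cannot reach the support of `φ`, so the inner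
    -- integral vanishes.
    · rw [Set.indicator_of_notMem hx]
      have hx' : ρ + 1 < ‖x‖ := by simpa using hx
      rw [norm_le_zero_iff]
      refine setIntegral_eq_zero_of_forall_eq_zero fun z hz => ?_
      have hz : ‖z‖ ≤ r := hz
      have h1 : ρ < ‖x + z‖ := by
        have := norm_sub_le (x + z) z
        rw [add_sub_cancel_right] at this
        linarith
      rw [hρ x (by linarith), hρ (x + z) h1, fderiv_eq_zero_of_norm_gt hρ (by linarith)]
      simp

lemma continuous_fderiv_of_smooth {φ : EuclideanSpace ℝ (Fin N) → ℝ} (hφ : ContDiff ℝ ∞ φ) :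
    Continuous (fderiv ℝ φ) :=
  hφ.continuous_fderiv (by simp)

lemma integrable_fderiv_apply {φ : EuclideanSpace ℝ (Fin N) → ℝ} (hφ : ContDiff ℝ ∞ φ)
    (hc : HasCompactSupport φ) {q : EuclideanSpace ℝ (Fin N) → EuclideanSpace ℝ (Fin N)}
    (hq : Measurable q) {C : ℝ} (hC : ∀ x, ‖q x‖ ≤ C) :
    Integrable fun x => fderiv ℝ φ x (q x) := by
  have hcont := continuous_fderiv_of_smooth hφ
  refine ((hcont.norm.integrable_of_hasCompactSupport
    (hc.fderiv ℝ).norm).mul_const C).mono' ?_ (Eventually.of_forall fun x => ?_)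
  · exact (isBoundedBilinearMap_apply.continuous.comp_stronglyMeasurable
      (hcont.stronglyMeasurable.prodMk hq.stronglyMeasurable)).aestronglyMeasurable
  · exact ((fderiv ℝ φ x).le_opNorm _).trans (by gcongr; exact hC x)

/-- The entropy inequality for Kruzhkov-type entropies. -/
theorem IsEntropySolution.kruzkov (hN : 1 ≤ N) (hs0 : 0 < s) (hs1 : s ≤ 1)
    (hb : Continuous b) (hF : LocallyLipschitz F)
    {f u : EuclideanSpace ℝ (Fin N) → ℝ} (h : IsEntropySolution s b F f u)
    (hf : Integrable f) (hu : Measurable u) {M : ℝ} (hM : ∀ x, |u x| ≤ M)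
    {k : ℝ} (hk : |k| ≤ M) {χ : ℕ → ℝ → ℝ} {χ' : ℝ → ℝ} (hχ : IsSignApprox k χ χ')
    {φ : EuclideanSpace ℝ (Fin N) → ℝ} (hφ : ContDiff ℝ ∞ φ) (hφ0 : ∀ x, 0 ≤ φ x) {ρ B r : ℝ}
    (hρ : ∀ x, ρ < ‖x‖ → φ x = 0)
    (hB : ∀ x z, |φ (x + z) - φ x - fderiv ℝ φ x z| ≤ B * ‖z‖ ^ 2) (hr : 0 < r) (hr1 : r ≤ 1) :
    0 ≤ (∫ x, ((f x - b (u x) + fracLapConst N s * truncatedOperator s r u x) * χ' (u x) * φ x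
        + fderiv ℝ φ x (χ' (u x) • (F (u x) - F k))))
      + fracLapConst N s * (2 * M * B *
        (∫ z in {z : EuclideanSpace ℝ (Fin N) | ‖z‖ ≤ r}, ‖z‖ ^ 2 * levyKernel N s z) *
        volume.real (Metric.closedBall (0 : EuclideanSpace ℝ (Fin N)) (ρ + 1))) := by
  have hs2 : s < 2 := by linarith
  have hc0 := fracLapConst_nonneg (N := N) hs0 hs1
  set c := fracLapConst N s
  have hφc : HasCompactSupport φ := by
    refine HasCompactSupport.intro (isCompact_closedBall 0 ρ) fun x hx => hρ x ?_
    simpa using hx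
  obtain ⟨Cb, hCb⟩ := (isCompact_Icc (a := -M) (b := M)).exists_bound_of_continuousOn
    hb.continuousOn
  obtain ⟨K, hK⟩ := hF.locallyLipschitzOn.exists_lipschitzOnWith_of_compact
    (s := Set.Icc (-M) M) isCompact_Icc
  have huM : ∀ x, u x ∈ Set.Icc (-M) M := fun x => abs_le.1 (hM x)
  set Cn := ∫ z in {z | r ≤ ‖z‖}, 2 * M * levyKernel N s z
  have hCn := abs_truncatedOperator_le hN hs0 hs2 hr hM
  have hTm := measurable_truncatedOperator (s := s) hu r
  -- the dominating function
  have hM0 : 0 ≤ M := (abs_nonneg _).trans hk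
  set CF : ℝ := K * (2 * M) + 2 * K
  have hFk : ∀ x, ‖F (u x) - F k‖ ≤ K * (2 * M) := by
    intro x
    rw [← dist_eq_norm]
    refine (hK.dist_le_mul _ (huM x) _ (abs_le.1 hk)).trans ?_
    gcongr
    rw [Real.dist_eq]
    calc |u x - k| ≤ |u x| + |k| := abs_sub _ _
      _ ≤ 2 * M := by linarith [hM x]
  have hΦ : ∀ n x, ‖fluxOf F (χ n) k (u x)‖ ≤ CF := by
    intro n x
    have h1 := hχ.norm_fluxOf_sub_le (F := F) hK hk n (hM x)
    have h2 : ‖χ n (u x) • (F (u x) - F k)‖ ≤ 1 * (K * (2 * M)) := by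
      rw [norm_smul]
      exact mul_le_mul (hχ.abs_le_one n _) (hFk x) (norm_nonneg _) zero_le_one
    have h3 : (1 : ℝ) / ((n : ℝ) + 1) ≤ 1 := by
      rw [div_le_one (by positivity)]
      simp
    have h4 : 2 * ((K : ℝ) * (1 / ((n : ℝ) + 1))) ≤ 2 * (K * 1) := by gcongr
    calc ‖fluxOf F (χ n) k (u x)‖
        = ‖(fluxOf F (χ n) k (u x) - χ n (u x) • (F (u x) - F k))
          + χ n (u x) • (F (u x) - F k)‖ := by rw [sub_add_cancel]
      _ ≤ _ := norm_add_le _ _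
      _ ≤ CF := by simp only [CF]; linarith
  have hφint : Integrable φ := hφ.continuous.integrable_of_hasCompactSupport hφc
  have hfφ : Integrable fun x => f x * φ x := by
    obtain ⟨Cφ, hCφ⟩ := hφ.continuous.bounded_above_of_compact_support hφc
    exact hf.mul_bdd hφ.continuous.aestronglyMeasurable (Eventually.of_forall hCφ)
  set D : EuclideanSpace ℝ (Fin N) → ℝ := fun x =>
    (‖f x * φ x‖ + (Cb + c * Cn) * ‖φ x‖) + ‖fderiv ℝ φ x‖ * CF
  have hcont := continuous_fderiv_of_smooth hφ
  have hD : Integrable D :=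
    (hfφ.norm.add (hφint.norm.const_mul _)).add ((hcont.norm.integrable_of_hasCompactSupport
      (hφc.fderiv ℝ).norm).mul_const CF)
  set T : ℕ → EuclideanSpace ℝ (Fin N) → ℝ := fun n x =>
    (f x - b (u x) + c * truncatedOperator s r u x) * χ n (u x) * φ x
        + fderiv ℝ φ x (fluxOf F (χ n) k (u x))
  have hΦc : ∀ n, Continuous (fluxOf F (χ n) k) := fun n =>
    (isEntropyFluxPair_entropyOf_fluxOf hF (hχ.contDiff n) (hχ.monotone n) k).3.continuous
  have hI1 : ∀ n, Integrable fun x => (f x - b (u x)) * χ n (u x) * φ x := by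
    intro n
    refine (hfφ.norm.add (hφint.norm.const_mul Cb)).mono' ?_ (Eventually.of_forall fun x => ?_)
    · exact ((hf.1.sub (hb.measurable.comp hu).aestronglyMeasurable).mul
        ((hχ.contDiff n).continuous.measurable.comp hu).aestronglyMeasurable).mul
        hφ.continuous.aestronglyMeasurable
    · have h1 := hχ.abs_le_one n (u x)
      have h2 := hCb _ (huM x)
      simp only [Real.norm_eq_abs, abs_mul, Pi.add_apply] at h2 ⊢
      calc |f x - b (u x)| * |χ n (u x)| * |φ x| ≤ (|f x| + |b (u x)|) * 1 * |φ x| := by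
            gcongr
            exact abs_sub _ _
        _ ≤ (|f x| + Cb) * 1 * |φ x| := by gcongr
        _ = _ := by ring
  have hI2 : ∀ n, Integrable fun x => fderiv ℝ φ x (fluxOf F (χ n) k (u x)) := fun n =>
    integrable_fderiv_apply hφ hφc ((hΦc n).measurable.comp hu) (hΦ n)
  have hI3 : ∀ n, Integrable fun x => χ n (u x) * truncatedOperator s r u x * φ x := by
    intro n
    refine (hφint.norm.const_mul Cn).mono' ?_ (Eventually.of_forall fun x => ?_)
    · exact ((((hχ.contDiff n).continuous.measurable.comp hu).mul hTm).aestronglyMeasurable).mul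
        hφ.continuous.aestronglyMeasurable
    · simp only [Real.norm_eq_abs, abs_mul]
      calc |χ n (u x)| * |truncatedOperator s r u x| * |φ x| ≤ 1 * Cn * |φ x| := by
            gcongr
            exacts [hχ.abs_le_one n _, hCn x]
        _ = _ := by ring
  have hstep : ∀ n, 0 ≤ (∫ x, T n x) + c * (2 * M * B *
        (∫ z in {z : EuclideanSpace ℝ (Fin N) | ‖z‖ ≤ r}, ‖z‖ ^ 2 * levyKernel N s z) *
        volume.real (Metric.closedBall (0 : EuclideanSpace ℝ (Fin N)) (ρ + 1))) := by
    intro n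
    have h1 := h.entropy_ineq r hr φ hφ hφc hφ0 _ _
      (isEntropyFluxPair_entropyOf_fluxOf hF (hχ.contDiff n) (hχ.monotone n) k)
    unfold entropyForm at h1
    -- The entropy is normalised at `k`, so its size is at most `|u x - k| ≤ 2 * M`. The resulting
    -- error bound is independent of `n`, and only the first integral has to pass to the limit.
    have h2 := abs_singularTerm_le hN hs0 hs2 hr1 hρ hB
      (g := fun x => entropyOf (χ n) k (u x)) (M := 2 * M) (fun x =>
        (abs_entropyOf_le (hχ.abs_le_one n) k (u x)).trans ((abs_sub _ _).trans
          (by linarith [hM x])))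
    have h3 : (∫ x, ∫ z in {z : EuclideanSpace ℝ (Fin N) | r ≤ ‖z‖},
        deriv (entropyOf (χ n) k) (u x) * ((u (x + z) - u x) / ‖z‖ ^ ((N : ℝ) + s)) * φ x)
        = ∫ x, χ n (u x) * truncatedOperator s r u x * φ x := by
      refine integral_congr_ae (Eventually.of_forall fun x => ?_)
      simp only [truncatedOperator, ← integral_const_mul, ← integral_mul_const,
        deriv_entropyOf (hχ.contDiff n).continuous, levyKernel, div_eq_mul_inv]
    have h4 : (∫ x, T n x) = (∫ x, ((f x - b (u x)) * deriv (entropyOf (χ n) k) (u x) * φ x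
        + fderiv ℝ φ x (fluxOf F (χ n) k (u x))))
        + c * ∫ x, χ n (u x) * truncatedOperator s r u x * φ x := by
      rw [deriv_entropyOf (hχ.contDiff n).continuous, ← integral_const_mul,
        ← integral_add (f := fun x => (f x - b (u x)) * χ n (u x) * φ x +
          fderiv ℝ φ x (fluxOf F (χ n) k (u x))) ((hI1 n).add (hI2 n)) ((hI3 n).const_mul c)]
      refine integral_congr_ae (Eventually.of_forall fun x => ?_)
      simp only [T]
      ring
    rw [h3, ← h4] at h1
    exact h1.trans (by gcongr; exact (le_abs_self _).trans h2)
  have hlim : Tendsto (fun n => ∫ x, T n x) atTop (𝓝 (∫ x,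
      ((f x - b (u x) + c * truncatedOperator s r u x) * χ' (u x) * φ x
        + fderiv ℝ φ x (χ' (u x) • (F (u x) - F k))))) := by
    refine tendsto_integral_of_dominated_convergence D (fun n => ?_) hD
      (fun n => Eventually.of_forall fun x => ?_) (Eventually.of_forall fun x => ?_)
    · exact ((((hf.1.sub (hb.measurable.comp hu).aestronglyMeasurable).add
        (hTm.const_mul c).aestronglyMeasurable).mul
        ((hχ.contDiff n).continuous.measurable.comp hu).aestronglyMeasurable).mul
        hφ.continuous.aestronglyMeasurable).add (hI2 n).1
    · have h1 := hχ.abs_le_one n (u x)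
      have h2 := hCb _ (huM x)
      refine (norm_add_le _ _).trans (add_le_add ?_ ?_)
      · simp only [Real.norm_eq_abs, abs_mul] at h2 ⊢
        calc |f x - b (u x) + c * truncatedOperator s r u x| * |χ n (u x)| * |φ x|
            ≤ (|f x| + |b (u x)| + c * |truncatedOperator s r u x|) * 1 * |φ x| := by
              gcongr
              refine (abs_add_le _ _).trans (add_le_add (abs_sub _ _) ?_)
              rw [abs_mul, abs_of_nonneg hc0]
          _ ≤ (|f x| + Cb + c * Cn) * 1 * |φ x| := by
              gcongr
              exact hCn x
          _ = _ := by ring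
      · exact ((fderiv ℝ φ x).le_opNorm _).trans (by gcongr; exact hΦ n x)
    · refine ((tendsto_const_nhds.mul (hχ.tendsto (u x))).mul_const _).add
        (((fderiv ℝ φ x).continuous.tendsto _).comp ?_)
      have h1 : Tendsto (fun n => fluxOf F (χ n) k (u x) - χ n (u x) • (F (u x) - F k)) atTop
          (𝓝 0) := by
        refine squeeze_zero_norm (fun n => hχ.norm_fluxOf_sub_le hK hk n (hM x)) ?_
        have := (tendsto_one_div_add_atTop_nhds_zero_nat (𝕜 := ℝ)).const_mul (K : ℝ)
        simpa using this.const_mul 2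
      have h2 := h1.add ((hχ.tendsto (u x)).smul_const (F (u x) - F k))
      simpa using h2
  exact ge_of_tendsto' (hlim.add_const _) hstep

end Kruzkov

/-! ### Integrals of `g x * J (x - y)` and `g y * J (x - y)` over the product. -/

section Shear

variable {G : Type*} [NormedAddCommGroup G] [MeasureSpace G] [BorelSpace G]
  [SecondCountableTopology G] [SigmaFinite (volume : Measure G)]
  [(volume : Measure G).IsAddHaarMeasure] {g J : G → ℝ}

/-- This is the integrand of a convolution, which the shear `(x, y) ↦ (x - y, y)` decouples.
Together with its variant in `x` it supplies the dominating functions for the doubled integrals. -/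
lemma integrable_snd_mul_sub (hg : Integrable g) (hJ : Integrable J) :
    Integrable fun p : G × G => g p.2 * J (p.1 - p.2) :=
  hg.convolution_integrand (ContinuousLinearMap.mul ℝ ℝ) hJ

lemma integral_snd_mul_sub (hg : Integrable g) (hJ : Integrable J) :
    ∫ p : G × G, g p.2 * J (p.1 - p.2) = (∫ x, g x) * ∫ x, J x := by
  have h := integral_prod_symm _ (integrable_snd_mul_sub hg hJ)
  refine h.trans ?_
  simp only [integral_const_mul]
  rw [← integral_mul_const]
  congr 1 with y
  rw [integral_sub_right_eq_self J y]

variable [(volume : Measure G).IsNegInvariant]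

lemma integrable_fst_mul_sub (hg : Integrable g) (hJ : Integrable J) :
    Integrable fun p : G × G => g p.1 * J (p.1 - p.2) := by
  have h := (integrable_snd_mul_sub hg hJ.comp_neg).swap
  refine h.congr (Eventually.of_forall fun p => ?_)
  simp

lemma integral_fst_mul_sub (hg : Integrable g) (hJ : Integrable J) :
    ∫ p : G × G, g p.1 * J (p.1 - p.2) = (∫ x, g x) * ∫ x, J x := by
  have h := integral_prod _ (integrable_fst_mul_sub hg hJ)
  refine h.trans ?_
  simp only [integral_const_mul]
  rw [← integral_mul_const]
  congr 1 with y
  rw [integral_sub_left_eq_self J volume y]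

end Shear

/-! ### Cutoffs and the doubled test function. -/

/-- A smooth nonnegative function vanishing outside the closed ball of radius `R`. -/
structure IsCutoff {N : ℕ} (φ : EuclideanSpace ℝ (Fin N) → ℝ) (R : ℝ) : Prop where
  contDiff : ContDiff ℝ ∞ φ
  nonneg : ∀ x, 0 ≤ φ x
  eq_zero : ∀ x, R < ‖x‖ → φ x = 0

namespace IsCutoff

variable {N : ℕ} {φ J : EuclideanSpace ℝ (Fin N) → ℝ} {R R' : ℝ}

lemma hasCompactSupport (h : IsCutoff φ R) : HasCompactSupport φ :=
  HasCompactSupport.intro (isCompact_closedBall 0 R) fun x hx => h.eq_zero x (by simpa using hx)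

lemma integrable (h : IsCutoff φ R) : Integrable φ :=
  h.contDiff.continuous.integrable_of_hasCompactSupport h.hasCompactSupport

lemma integrable_norm_fderiv (h : IsCutoff φ R) : Integrable fun x => ‖fderiv ℝ φ x‖ :=
  (continuous_fderiv_of_smooth h.contDiff).norm.integrable_of_hasCompactSupport
    (h.hasCompactSupport.fderiv ℝ).norm

lemma exists_bound (h : IsCutoff φ R) : ∃ C, ∀ x, φ x ≤ C := by
  obtain ⟨C, hC⟩ := h.contDiff.continuous.bounded_above_of_compact_support h.hasCompactSupport
  exact ⟨C, fun x => (le_abs_self _).trans (hC x)⟩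

/-- The doubled test function `φ x * J (x - y)` has second order Taylor remainders in `x` and in
`y` that are bounded uniformly. -/
lemma exists_taylor_bound_doubled (h : IsCutoff φ R) (hJ : IsCutoff J R') :
    ∃ B : ℝ, 0 ≤ B ∧
      (∀ y x z, |φ (x + z) * J (x + z - y) - φ x * J (x - y) -
        fderiv ℝ (fun x => φ x * J (x - y)) x z| ≤ B * ‖z‖ ^ 2) ∧
      (∀ x y z, |φ x * J (x - (y + z)) - φ x * J (x - y) -
        fderiv ℝ (fun y => φ x * J (x - y)) y z| ≤ B * ‖z‖ ^ 2) := by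
  set Ψ : EuclideanSpace ℝ (Fin N) × EuclideanSpace ℝ (Fin N) → ℝ :=
    fun p => φ p.1 * J (p.1 - p.2) with hΨdef
  have hΨ : ContDiff ℝ ∞ Ψ :=
    (h.contDiff.comp contDiff_fst).mul (hJ.contDiff.comp (contDiff_fst.sub contDiff_snd))
  have hΨc : HasCompactSupport Ψ := by
    refine HasCompactSupport.intro ((isCompact_closedBall
      (0 : EuclideanSpace ℝ (Fin N)) R).prod (isCompact_closedBall
      (0 : EuclideanSpace ℝ (Fin N)) (R + R'))) fun p hp => ?_
    by_cases hx : R < ‖p.1‖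
    · simp [hΨdef, h.eq_zero _ hx]
    · have hp2 : R + R' < ‖p.2‖ := by
        by_contra hcon
        exact hp ⟨by simpa using hx, by simpa using hcon⟩
      have : R' < ‖p.1 - p.2‖ := by
        have := norm_sub_norm_le p.2 p.1
        rw [norm_sub_rev] at this
        linarith
      simp [hΨdef, hJ.eq_zero _ this]
  -- One Taylor bound on the product space, applied to the increments `(z, 0)` and `(0, z)`, gives a
  -- constant that does not depend on the frozen variable.
  obtain ⟨B, hB0, hB⟩ := exists_taylor_bound hΨ hΨc
  have hΨd : Differentiable ℝ Ψ := hΨ.differentiable (by simp)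
  refine ⟨B, hB0, fun y x z => ?_, fun x y z => ?_⟩
  · have h1 : HasFDerivAt (fun x => φ x * J (x - y))
        ((fderiv ℝ Ψ (x, y)).comp (ContinuousLinearMap.inl ℝ _ _)) x :=
      HasFDerivAt.comp (g := Ψ) (f := fun x => (x, y)) x (hΨd (x, y)).hasFDerivAt
        (hasFDerivAt_prodMk_left x y)
    have h2 := hB (x, y) (z, 0)
    rw [h1.fderiv]
    simpa [Ψ, Prod.norm_def] using h2
  · have h1 : HasFDerivAt (fun y => φ x * J (x - y))
        ((fderiv ℝ Ψ (x, y)).comp (ContinuousLinearMap.inr ℝ _ _)) y :=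
      HasFDerivAt.comp (g := Ψ) (f := fun y => (x, y)) y (hΨd (x, y)).hasFDerivAt
        (hasFDerivAt_prodMk_right x y)
    have h2 := hB (x, y) (0, z)
    rw [h1.fderiv]
    simpa [Ψ, Prod.norm_def] using h2

lemma fderiv_doubled_fst (h : IsCutoff φ R) (hJ : IsCutoff J R')
    (x y p : EuclideanSpace ℝ (Fin N)) :
    fderiv ℝ (fun x => φ x * J (x - y)) x p =
      J (x - y) * fderiv ℝ φ x p + φ x * fderiv ℝ J (x - y) p := by
  have h1 := (h.contDiff.differentiable (by simp) x).hasFDerivAt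
  have h2 : HasFDerivAt (fun x => J (x - y)) (fderiv ℝ J (x - y)) x := by
    have h3 := (hJ.contDiff.differentiable (by simp) (x - y)).hasFDerivAt.comp x
      ((hasFDerivAt_id x).sub_const y)
    exact h3.congr_fderiv (by ext; simp)
  have h4 : HasFDerivAt (fun x => φ x * J (x - y)) _ x := h1.mul h2
  rw [h4.fderiv]
  simp
  ring

/-- The gradient of `J` appears with the sign opposite to that in `fderiv_doubled_fst`. As both
Kruzhkov fluxes equal `F (u x) - F (v y)` on `{v y < u x}` up to a sign absorbed by the entropies,
these terms cancel. The cutoff depends on `x` alone, so no other term arises here. -/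
lemma fderiv_doubled_snd (hJ : IsCutoff J R') (x y p : EuclideanSpace ℝ (Fin N)) :
    fderiv ℝ (fun y => φ x * J (x - y)) y p = -(φ x * fderiv ℝ J (x - y) p) := by
  have h2 : HasFDerivAt (fun y => J (x - y)) (-fderiv ℝ J (x - y)) y := by
    have h3 := (hJ.contDiff.differentiable (by simp) (x - y)).hasFDerivAt.comp y
      ((hasFDerivAt_id y).const_sub x)
    simpa [Function.comp_def] using h3
  rw [(h2.const_mul (φ x)).fderiv]
  simp

end IsCutoff

/-! ### Doubling of variables. -/

section Doubling

variable {N : ℕ} {s : ℝ} {b : ℝ → ℝ} {F : ℝ → EuclideanSpace ℝ (Fin N)}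

/-- The contribution at `(x, y)` to the sum of the two Kruzhkov inequalities. -/
noncomputable def doubledIntegrand (s : ℝ) (b : ℝ → ℝ) (F : ℝ → EuclideanSpace ℝ (Fin N))
    (f f' u v φ J : EuclideanSpace ℝ (Fin N) → ℝ) (r : ℝ)
    (p : EuclideanSpace ℝ (Fin N) × EuclideanSpace ℝ (Fin N)) : ℝ :=
  if v p.2 < u p.1 then
    ((f p.1 - f' p.2) - (b (u p.1) - b (v p.2)) + fracLapConst N s *
      (truncatedOperator s r u p.1 - truncatedOperator s r v p.2)) * (φ p.1 * J (p.1 - p.2)) +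
      J (p.1 - p.2) * fderiv ℝ φ p.1 (F (u p.1) - F (v p.2))
  else 0

lemma measurable_fderiv_apply {X : Type*} [MeasurableSpace X]
    {φ : EuclideanSpace ℝ (Fin N) → ℝ} (hφ : ContDiff ℝ ∞ φ)
    {a q : X → EuclideanSpace ℝ (Fin N)} (ha : Measurable a) (hq : Measurable q) :
    Measurable fun x => fderiv ℝ φ (a x) (q x) :=
  (isBoundedBilinearMap_apply.continuous.comp_stronglyMeasurable
    (((continuous_fderiv_of_smooth hφ).measurable.comp ha).stronglyMeasurable.prodMk
      hq.stronglyMeasurable)).measurable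

/-- The inequality for `u` at level `v y` is integrated in `y`, the one for `v` at level `u x` in
`x`, and the two are added. The constant `C` is chosen before `r`, so the last term disappears as `r
→ 0`. -/
theorem exists_doubled_inequality (hN : 1 ≤ N) (hs0 : 0 < s) (hs1 : s ≤ 1)
    (hb : Continuous b) (hF : LocallyLipschitz F)
    {f f' u v : EuclideanSpace ℝ (Fin N) → ℝ}
    (h : IsEntropySolution s b F f u) (h' : IsEntropySolution s b F f' v)
    (hf : Integrable f) (hfm : Measurable f) (hf' : Integrable f') (hfm' : Measurable f')
    (hu : Measurable u) (hv : Measurable v)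
    {M : ℝ} (hM : ∀ x, |u x| ≤ M) (hM' : ∀ x, |v x| ≤ M)
    {φ J : EuclideanSpace ℝ (Fin N) → ℝ} {R R' : ℝ} (hR' : 0 ≤ R') (hφ : IsCutoff φ R)
    (hJ : IsCutoff J R') :
    ∃ C : ℝ, ∀ r : ℝ, 0 < r → r ≤ 1 →
      Integrable (doubledIntegrand s b F f f' u v φ J r) ∧
      0 ≤ (∫ p, doubledIntegrand s b F f f' u v φ J r p) +
        C * ∫ z in {z : EuclideanSpace ℝ (Fin N) | ‖z‖ ≤ r}, ‖z‖ ^ 2 * levyKernel N s z := by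
  obtain ⟨B, hB0, hB1, hB2⟩ := hφ.exists_taylor_bound_doubled hJ
  have hs2 : s < 2 := by linarith
  have hc0 := fracLapConst_nonneg (N := N) hs0 hs1
  set c := fracLapConst N s with hc
  have hM0 : 0 ≤ M := (abs_nonneg _).trans (hM 0)
  obtain ⟨Cb, hCb⟩ := (isCompact_Icc (a := -M) (b := M)).exists_bound_of_continuousOn
    hb.continuousOn
  obtain ⟨CF, hCF⟩ := (isCompact_Icc (a := -M) (b := M)).exists_bound_of_continuousOn
    hF.continuous.continuousOn
  obtain ⟨Cφ, hCφ⟩ := hφ.exists_bound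
  have hCb0 : 0 ≤ Cb := (norm_nonneg _).trans (hCb 0 (by simp [hM0]))
  have hCF0 : 0 ≤ CF := (norm_nonneg _).trans (hCF 0 (by simp [hM0]))
  set V := volume.real (Metric.closedBall (0 : EuclideanSpace ℝ (Fin N)) (R + R' + 1))
  set V' := volume.real (Metric.closedBall (0 : EuclideanSpace ℝ (Fin N)) (R + R'))
  -- `V` is the volume appearing in each Kruzhkov error, `V'` comes from integrating that error in
  -- the frozen variable, and the factor `2` counts the two inequalities.
  refine ⟨2 * (V' * (c * (2 * M * B * V))), fun r hr hr1 => ?_⟩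
  set W := ∫ z in {z : EuclideanSpace ℝ (Fin N) | ‖z‖ ≤ r}, ‖z‖ ^ 2 * levyKernel N s z
  have hTu := measurable_truncatedOperator (s := s) hu r
  have hTv := measurable_truncatedOperator (s := s) hv r
  set Cn := ∫ z in {z : EuclideanSpace ℝ (Fin N) | r ≤ ‖z‖}, 2 * M * levyKernel N s z
  have hCn := abs_truncatedOperator_le hN hs0 hs2 hr hM
  have hCn' := abs_truncatedOperator_le hN hs0 hs2 hr hM'
  have hCn0 : 0 ≤ Cn := (abs_nonneg _).trans (hCn 0)
  have hφm := hφ.contDiff.continuous.measurable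
  have hJm := hJ.contDiff.continuous.measurable
  have hbm := hb.measurable
  have hFm := hF.continuous.measurable
  have hlt : MeasurableSet {p : EuclideanSpace ℝ (Fin N) × EuclideanSpace ℝ (Fin N) |
      v p.2 < u p.1} := measurableSet_lt (by fun_prop) (by fun_prop)
  -- the two integrands
  set χ : EuclideanSpace ℝ (Fin N) × EuclideanSpace ℝ (Fin N) → ℝ :=
    fun p => if v p.2 < u p.1 then 1 else 0
  have hχm : Measurable χ := Measurable.ite hlt measurable_const measurable_const
  have hχ1 : ∀ p, |χ p| ≤ 1 := fun p => by simp only [χ]; split_ifs <;> simp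
  set q : EuclideanSpace ℝ (Fin N) × EuclideanSpace ℝ (Fin N) → EuclideanSpace ℝ (Fin N) :=
    fun p => χ p • (F (u p.1) - F (v p.2))
  have hqm : Measurable q := by fun_prop
  have hq1 : ∀ p, ‖q p‖ ≤ 2 * CF := by
    intro p
    rw [norm_smul]
    calc ‖χ p‖ * ‖F (u p.1) - F (v p.2)‖ ≤ 1 * (CF + CF) := by
          gcongr
          · exact hχ1 p
          · exact (norm_sub_le _ _).trans
              (add_le_add (hCF _ (abs_le.1 (hM _))) (hCF _ (abs_le.1 (hM' _))))
      _ = 2 * CF := by ring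
  set Q₁ : EuclideanSpace ℝ (Fin N) × EuclideanSpace ℝ (Fin N) → ℝ := fun p =>
    (f p.1 - b (u p.1) + c * truncatedOperator s r u p.1) * χ p * (φ p.1 * J (p.1 - p.2)) +
      (J (p.1 - p.2) * fderiv ℝ φ p.1 (q p) + φ p.1 * fderiv ℝ J (p.1 - p.2) (q p)) with hQ₁
  set Q₂ : EuclideanSpace ℝ (Fin N) × EuclideanSpace ℝ (Fin N) → ℝ := fun p =>
    (f' p.2 - b (v p.2) + c * truncatedOperator s r v p.2) * (-χ p) * (φ p.1 * J (p.1 - p.2)) -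
      φ p.1 * fderiv ℝ J (p.1 - p.2) (q p) with hQ₂
  have hDφ : Measurable fun p => fderiv ℝ φ p.1 (q p) :=
    measurable_fderiv_apply hφ.contDiff measurable_fst hqm
  have hDJ : Measurable fun p => fderiv ℝ J (p.1 - p.2) (q p) :=
    measurable_fderiv_apply hJ.contDiff (measurable_fst.sub measurable_snd) hqm
  have hfφ : Integrable fun x => (|f x| + (Cb + c * Cn)) * φ x := by
    have h1 : Integrable fun x => |f x| * φ x :=
      hf.abs.mul_bdd hφm.aestronglyMeasurable (Eventually.of_forall fun x => by
        rw [Real.norm_of_nonneg (hφ.nonneg x)]; exact hCφ x)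
    refine (h1.add (hφ.integrable.const_mul (Cb + c * Cn))).congr
      (Eventually.of_forall fun x => ?_)
    simp only [Pi.add_apply]
    ring
  have hint₁ : Integrable Q₁ := by
    refine ((integrable_fst_mul_sub hfφ hJ.integrable).add
      ((integrable_fst_mul_sub (hφ.integrable_norm_fderiv.const_mul (2 * CF)) hJ.integrable).add
        (integrable_fst_mul_sub (hφ.integrable.const_mul (2 * CF))
          hJ.integrable_norm_fderiv))).mono' ?_ (Eventually.of_forall fun p => ?_)
    · refine Measurable.aestronglyMeasurable ?_
      fun_prop
    · have hφ0 := hφ.nonneg p.1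
      have hJ0 := hJ.nonneg (p.1 - p.2)
      refine (norm_add_le _ _).trans (add_le_add ?_ ((norm_add_le _ _).trans (add_le_add ?_ ?_)))
      · simp only [Real.norm_eq_abs, abs_mul, abs_of_nonneg hφ0, abs_of_nonneg hJ0]
        rw [← mul_assoc]
        gcongr
        calc |f p.1 - b (u p.1) + c * truncatedOperator s r u p.1| * |χ p|
            ≤ (|f p.1| + (Cb + c * Cn)) * 1 := by
              gcongr
              · refine (abs_add_le _ _).trans ?_
                rw [abs_mul, abs_of_nonneg hc0, ← add_assoc]
                gcongr
                · exact (abs_sub _ _).trans (by gcongr; exact hCb _ (abs_le.1 (hM _)))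
                · exact hCn _
              · exact hχ1 p
          _ = _ := mul_one _
      · rw [norm_mul, Real.norm_of_nonneg hJ0, mul_comm]
        refine mul_le_mul_of_nonneg_right ?_ hJ0
        rw [mul_comm]
        exact (ContinuousLinearMap.le_opNorm _ _).trans (by gcongr; exact hq1 p)
      · rw [norm_mul, Real.norm_of_nonneg hφ0]
        calc φ p.1 * ‖fderiv ℝ J (p.1 - p.2) (q p)‖
            ≤ φ p.1 * (‖fderiv ℝ J (p.1 - p.2)‖ * (2 * CF)) := by
              gcongr
              exact (ContinuousLinearMap.le_opNorm _ _).trans (by gcongr; exact hq1 p)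
          _ = _ := by ring
  have hint₂ : Integrable Q₂ := by
    -- Here `f'` depends on `y` while the cutoff depends on `x`, so `φ` is replaced by its supremum
    -- and integrability comes from `f'` and `J`.
    refine (((integrable_snd_mul_sub (hf'.abs.const_mul Cφ) hJ.integrable).add
      (integrable_fst_mul_sub (hφ.integrable.const_mul (Cb + c * Cn)) hJ.integrable)).add
        (integrable_fst_mul_sub (hφ.integrable.const_mul (2 * CF))
          hJ.integrable_norm_fderiv)).mono' ?_ (Eventually.of_forall fun p => ?_)
    · refine Measurable.aestronglyMeasurable ?_
      fun_prop
    · have hφ0 := hφ.nonneg p.1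
      have hJ0 := hJ.nonneg (p.1 - p.2)
      refine (norm_sub_le _ _).trans (add_le_add ?_ ?_)
      · simp only [Real.norm_eq_abs, abs_mul, abs_neg, abs_of_nonneg hφ0, abs_of_nonneg hJ0,
          Pi.add_apply]
        calc |f' p.2 - b (v p.2) + c * truncatedOperator s r v p.2| * |χ p| *
              (φ p.1 * J (p.1 - p.2))
            ≤ (|f' p.2| + (Cb + c * Cn)) * 1 * (φ p.1 * J (p.1 - p.2)) := by
              gcongr
              · refine (abs_add_le _ _).trans ?_
                rw [abs_mul, abs_of_nonneg hc0, ← add_assoc]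
                gcongr
                · exact (abs_sub _ _).trans (by gcongr; exact hCb _ (abs_le.1 (hM' _)))
                · exact hCn' _
              · exact hχ1 p
          _ = φ p.1 * |f' p.2| * J (p.1 - p.2) + (Cb + c * Cn) * φ p.1 * J (p.1 - p.2) := by ring
          _ ≤ _ := by
              gcongr
              exact hCφ _
      · rw [norm_mul, Real.norm_of_nonneg hφ0]
        calc φ p.1 * ‖fderiv ℝ J (p.1 - p.2) (q p)‖
            ≤ φ p.1 * (‖fderiv ℝ J (p.1 - p.2)‖ * (2 * CF)) := by
              gcongr
              exact (ContinuousLinearMap.le_opNorm _ _).trans (by gcongr; exact hq1 p)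
          _ = _ := by ring
  have hsum : ∀ p, doubledIntegrand s b F f f' u v φ J r p = Q₁ p + Q₂ p := by
    intro p
    simp only [doubledIntegrand, hQ₁, hQ₂, q, χ]
    split_ifs
    · rw [one_smul]; ring
    · simp
  have hball : MeasurableSet (Metric.closedBall (0 : EuclideanSpace ℝ (Fin N)) (R + R')) :=
    Metric.isClosed_closedBall.measurableSet
  set e := c * (2 * M * B * W * V)
  set E₀ := (Metric.closedBall (0 : EuclideanSpace ℝ (Fin N)) (R + R')).indicator fun _ => e
  have hE₀ : Integrable E₀ := (integrable_indicator_iff hball).2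
      (integrableOn_const (isCompact_closedBall _ _).measure_lt_top.ne)
  have hE₀int : ∫ y, E₀ y = V' * e := by
    rw [integral_indicator hball, setIntegral_const, smul_eq_mul]
  have hpoint : ∀ x y, R + R' < ‖y‖ → φ x * J (x - y) = 0 := by
    intro x y hy
    by_cases hx : R < ‖x‖
    · simp [hφ.eq_zero _ hx]
    · have : R' < ‖x - y‖ := by
        have := norm_sub_norm_le y x
        rw [norm_sub_rev] at this
        linarith
      simp [hJ.eq_zero _ this]
  have hineq₁ : 0 ≤ (∫ p, Q₁ p) + V' * e := by
    have h1 : ∀ y, 0 ≤ (∫ x, Q₁ (x, y)) + E₀ y := by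
      intro y
      have hψ : ContDiff ℝ ∞ fun x => φ x * J (x - y) :=
        hφ.contDiff.mul (hJ.contDiff.comp (contDiff_id.sub contDiff_const))
      have hψ0 : ∀ x, 0 ≤ φ x * J (x - y) := fun x => mul_nonneg (hφ.nonneg _) (hJ.nonneg _)
      have hψR : ∀ x, R + R' < ‖x‖ → φ x * J (x - y) = 0 := fun x hx => by
        rw [hφ.eq_zero x (by linarith), zero_mul]
      have hQeq : ∀ x, (f x - b (u x) + c * truncatedOperator s r u x) *
          (if v y < u x then 1 else 0) * (φ x * J (x - y)) +
          fderiv ℝ (fun x => φ x * J (x - y)) x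
            ((if v y < u x then (1 : ℝ) else 0) • (F (u x) - F (v y))) = Q₁ (x, y) := by
        intro x
        rw [hφ.fderiv_doubled_fst hJ]
      by_cases hy : y ∈ Metric.closedBall (0 : EuclideanSpace ℝ (Fin N)) (R + R')
      · have h2 := h.kruzkov hN hs0 hs1 hb hF hf hu hM (hM' y) (isSignApprox_pos (v y))
          hψ hψ0 hψR (hB1 y) hr hr1
        simp only [hQeq, ← hc] at h2
        simpa only [E₀, Set.indicator_of_mem hy] using h2
      · have hzero : (fun x => φ x * J (x - y)) = fun _ => 0 :=
          funext fun x => hpoint x y (by simpa using hy)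
        -- For such `y` the test function is identically zero and `B = 0` is allowed. The error is
        -- thus supported in a ball and can be integrated in `y`.
        have h2 := h.kruzkov hN hs0 hs1 hb hF hf hu hM (hM' y) (isSignApprox_pos (v y))
          hψ hψ0 hψR (B := 0) (fun x z => by
            rw [hzero, show φ x * J (x - y) = 0 from congrFun hzero x,
              show φ (x + z) * J (x + z - y) = 0 from congrFun hzero (x + z)]
            simp) hr hr1
        simp only [← hc, hQeq, mul_zero, zero_mul] at h2
        simpa only [E₀, Set.indicator_of_notMem hy] using h2
    have h2 := integral_nonneg (μ := volume) (f := fun y => (∫ x, Q₁ (x, y)) + E₀ y) h1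
    rw [integral_add hint₁.integral_prod_right hE₀, hE₀int] at h2
    rw [Measure.volume_eq_prod, integral_prod_symm _ hint₁]
    exact h2
  have hineq₂ : 0 ≤ (∫ p, Q₂ p) + V' * e := by
    have h1 : ∀ x, 0 ≤ (∫ y, Q₂ (x, y)) + E₀ x := by
      intro x
      have hψ : ContDiff ℝ ∞ fun y => φ x * J (x - y) :=
        contDiff_const.mul (hJ.contDiff.comp (contDiff_const.sub contDiff_id))
      have hψ0 : ∀ y, 0 ≤ φ x * J (x - y) := fun y => mul_nonneg (hφ.nonneg _) (hJ.nonneg _)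
      have hQeq : ∀ y, (f' y - b (v y) + c * truncatedOperator s r v y) *
          (if v y < u x then -1 else 0) * (φ x * J (x - y)) +
          fderiv ℝ (fun y => φ x * J (x - y)) y
            ((if v y < u x then (-1 : ℝ) else 0) • (F (v y) - F (u x))) = Q₂ (x, y) := by
        intro y
        rw [hJ.fderiv_doubled_snd]
        simp only [hQ₂, q, χ]
        split_ifs
        · rw [one_smul, neg_one_smul, neg_sub]
          ring
        · simp
      by_cases hx : x ∈ Metric.closedBall (0 : EuclideanSpace ℝ (Fin N)) (R + R')
      · have h2 := h'.kruzkov hN hs0 hs1 hb hF hf' hv hM' (hM x) (isSignApprox_neg (u x))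
          hψ hψ0 (hpoint x) (hB2 x) hr hr1
        simp only [hQeq, ← hc] at h2
        simpa only [E₀, Set.indicator_of_mem hx] using h2
      · have hzero : (fun y => φ x * J (x - y)) = fun _ => 0 :=
          funext fun y => by
            have : R + R' < ‖x‖ := by simpa using hx
            rw [hφ.eq_zero x (by linarith), zero_mul]
        have h2 := h'.kruzkov hN hs0 hs1 hb hF hf' hv hM' (hM x) (isSignApprox_neg (u x))
          hψ hψ0 (hpoint x) (B := 0) (fun y z => by
            rw [hzero, show φ x * J (x - y) = 0 from congrFun hzero y,
              show φ x * J (x - (y + z)) = 0 from congrFun hzero (y + z)]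
            simp) hr hr1
        simp only [← hc, hQeq, mul_zero, zero_mul] at h2
        simpa only [E₀, Set.indicator_of_notMem hx] using h2
    have h2 := integral_nonneg (μ := volume) (f := fun x => (∫ y, Q₂ (x, y)) + E₀ x) h1
    rw [integral_add hint₂.integral_prod_left hE₀, hE₀int] at h2
    rw [Measure.volume_eq_prod, integral_prod _ hint₂]
    exact h2
  refine ⟨(hint₁.add hint₂).congr (Eventually.of_forall fun p => (hsum p).symm), ?_⟩
  simp only [hsum]
  rw [integral_add hint₁ hint₂]
  have he : 2 * (V' * (c * (2 * M * B * V))) * W = V' * e + V' * e := by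
    simp only [e]; ring
  rw [he]
  linarith

end Doubling

/-! ### The nonlocal term: convexity and diagonal translation. -/

section Nonlocal

variable {N : ℕ} {s : ℝ}

lemma IsCutoff.integrable_doubled {φ J : EuclideanSpace ℝ (Fin N) → ℝ} {R R' : ℝ}
    (hφ : IsCutoff φ R) (hJ : IsCutoff J R') :
    Integrable fun p : EuclideanSpace ℝ (Fin N) × EuclideanSpace ℝ (Fin N) =>
      φ p.1 * J (p.1 - p.2) :=
  integrable_fst_mul_sub hφ.integrable hJ.integrable

lemma integrable_posPart_sub_mul {g g' J : EuclideanSpace ℝ (Fin N) → ℝ} {R' : ℝ}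
    (hg : Integrable g) (hg' : Integrable g') (hgm : Measurable g) (hgm' : Measurable g')
    (hJ : IsCutoff J R') :
    Integrable fun p : EuclideanSpace ℝ (Fin N) × EuclideanSpace ℝ (Fin N) =>
      max (g p.1 - g' p.2) 0 * J (p.1 - p.2) := by
  have hJm := hJ.contDiff.continuous.measurable
  refine ((integrable_fst_mul_sub hg.abs hJ.integrable).add
    (integrable_snd_mul_sub hg'.abs hJ.integrable)).mono' (by fun_prop)
    (Eventually.of_forall fun p => ?_)
  have hJ0 := hJ.nonneg (p.1 - p.2)
  rw [norm_mul, Real.norm_of_nonneg hJ0, Real.norm_of_nonneg (le_max_right _ _), Pi.add_apply,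
    ← add_mul]
  gcongr
  exact max_le (by linarith [le_abs_self (g p.1), neg_abs_le (g' p.2)]) (by positivity)

lemma integral_posPart_sub_mul_le {g g' J : EuclideanSpace ℝ (Fin N) → ℝ} {R' : ℝ}
    (hg : Integrable g) (hg' : Integrable g') (hgm : Measurable g) (hgm' : Measurable g')
    (hJ : IsCutoff J R') (hJ1 : ∫ z, J z = 1) :
    ∫ p : EuclideanSpace ℝ (Fin N) × EuclideanSpace ℝ (Fin N),
      max (g p.1 - g' p.2) 0 * J (p.1 - p.2) ≤ (∫ x, |g x|) + ∫ x, |g' x| := by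
  have h1 := integral_fst_mul_sub hg.abs hJ.integrable
  have h2 := integral_snd_mul_sub hg'.abs hJ.integrable
  rw [hJ1, mul_one] at h1 h2
  rw [← h1, ← h2, ← integral_add (integrable_fst_mul_sub hg.abs hJ.integrable)
    (integrable_snd_mul_sub hg'.abs hJ.integrable)]
  refine integral_mono (integrable_posPart_sub_mul hg hg' hgm hgm' hJ)
    ((integrable_fst_mul_sub hg.abs hJ.integrable).add
    (integrable_snd_mul_sub hg'.abs hJ.integrable)) fun p => ?_
  have hJ0 := hJ.nonneg (p.1 - p.2)
  simp only [← add_mul]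
  gcongr
  exact max_le (by linarith [le_abs_self (g p.1), neg_abs_le (g' p.2)]) (by positivity)

lemma integrableOn_increment_mul_levyKernel (hN : 1 ≤ N) (hs0 : 0 < s) (hs2 : s < 2) {r : ℝ}
    (hr : 0 < r) {g : EuclideanSpace ℝ (Fin N) → ℝ} (hg : Measurable g) {M : ℝ}
    (hM : ∀ x, |g x| ≤ M) :
    IntegrableOn (fun z => g z * levyKernel N s z) {z | r ≤ ‖z‖} :=
  (integrableOn_levyKernel hN hs0 hs2 hr).bdd_mul hg.aestronglyMeasurable
    (Eventually.of_forall hM)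

/-- The nonlocal term of the doubled inequality, moved onto the cutoff. -/
theorem integral_truncatedOperator_doubled_le (hN : 1 ≤ N) (hs0 : 0 < s) (hs2 : s < 2)
    {u v : EuclideanSpace ℝ (Fin N) → ℝ} (hu : Measurable u) (hv : Measurable v)
    (hui : Integrable u) (hvi : Integrable v)
    {M : ℝ} (hM : ∀ x, |u x| ≤ M) (hM' : ∀ x, |v x| ≤ M)
    {φ J : EuclideanSpace ℝ (Fin N) → ℝ} {R R' : ℝ} (hφ : IsCutoff φ R) (hJ : IsCutoff J R')
    {m : EuclideanSpace ℝ (Fin N) → ℝ}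
    (hm : ∀ x z, φ (x - z) + φ (x + z) - 2 * φ x ≤ m z) (hm0 : ∀ z, 0 ≤ m z)
    (hmi : Integrable fun z => m z * levyKernel N s z) {r : ℝ} (hr : 0 < r) :
    (Integrable fun p : EuclideanSpace ℝ (Fin N) × EuclideanSpace ℝ (Fin N) =>
      (if v p.2 < u p.1 then truncatedOperator s r u p.1 - truncatedOperator s r v p.2 else 0) *
        (φ p.1 * J (p.1 - p.2))) ∧
    ∫ p : EuclideanSpace ℝ (Fin N) × EuclideanSpace ℝ (Fin N),
      (if v p.2 < u p.1 then truncatedOperator s r u p.1 - truncatedOperator s r v p.2 else 0) *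
        (φ p.1 * J (p.1 - p.2)) ≤
    1 / 2 * (∫ z, m z * levyKernel N s z) *
      ∫ p : EuclideanSpace ℝ (Fin N) × EuclideanSpace ℝ (Fin N),
        max (u p.1 - v p.2) 0 * J (p.1 - p.2) := by
  have hM0 : 0 ≤ M := (abs_nonneg _).trans (hM 0)
  have hTu := measurable_truncatedOperator (s := s) hu r
  have hTv := measurable_truncatedOperator (s := s) hv r
  set Cn := ∫ z in {z : EuclideanSpace ℝ (Fin N) | r ≤ ‖z‖}, 2 * M * levyKernel N s z
  have hCn := abs_truncatedOperator_le hN hs0 hs2 hr hM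
  have hCn' := abs_truncatedOperator_le hN hs0 hs2 hr hM'
  have hφm := hφ.contDiff.continuous.measurable
  have hJm := hJ.contDiff.continuous.measurable
  have hwm := measurable_levyKernel (N := N) (s := s)
  have hS : MeasurableSet {z : EuclideanSpace ℝ (Fin N) | r ≤ ‖z‖} :=
    measurableSet_le measurable_const measurable_norm
  set A : EuclideanSpace ℝ (Fin N) × EuclideanSpace ℝ (Fin N) → ℝ :=
    fun p => max (u p.1 - v p.2) 0 with hA
  have hAm : Measurable A := by fun_prop
  have hA0 : ∀ p, 0 ≤ A p := fun p => le_max_right _ _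
  have hA1 : ∀ p, A p ≤ 2 * M := fun p => max_le
    (by linarith [abs_le.1 (hM p.1), abs_le.1 (hM' p.2)]) (by linarith)
  set Ψ : EuclideanSpace ℝ (Fin N) × EuclideanSpace ℝ (Fin N) → ℝ :=
    fun p => φ p.1 * J (p.1 - p.2) with hΨ
  have hΨi : Integrable Ψ := hφ.integrable_doubled hJ
  have hΨm : Measurable Ψ := by fun_prop
  have hΨ0 : ∀ p, 0 ≤ Ψ p := fun p => mul_nonneg (hφ.nonneg _) (hJ.nonneg _)
  have hlt : MeasurableSet {p : EuclideanSpace ℝ (Fin N) × EuclideanSpace ℝ (Fin N) |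
      v p.2 < u p.1} := measurableSet_lt (by fun_prop) (by fun_prop)
  set L : EuclideanSpace ℝ (Fin N) × EuclideanSpace ℝ (Fin N) → ℝ := fun p =>
    if v p.2 < u p.1 then truncatedOperator s r u p.1 - truncatedOperator s r v p.2 else 0 with hL
  have hLm : Measurable L := Measurable.ite hlt (by fun_prop) measurable_const
  have hLi : Integrable fun p => L p * Ψ p := by
    refine hΨi.bdd_mul (c := 2 * Cn) hLm.aestronglyMeasurable (Eventually.of_forall fun p => ?_)
    have hCn0 : 0 ≤ Cn := (abs_nonneg _).trans (hCn 0)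
    simp only [hL]
    split_ifs
    · exact (abs_sub _ _).trans (by linarith [hCn p.1, hCn' p.2])
    · simpa using hCn0
  refine ⟨hLi, ?_⟩
  have hAJ : Integrable fun p : EuclideanSpace ℝ (Fin N) × EuclideanSpace ℝ (Fin N) =>
      A p * J (p.1 - p.2) :=
    integrable_posPart_sub_mul hui hvi hu hv hJ
  -- pointwise convexity
  have hinc : Integrable (fun q : (EuclideanSpace ℝ (Fin N) × EuclideanSpace ℝ (Fin N)) ×
      EuclideanSpace ℝ (Fin N) => (A (q.1 + (q.2, q.2)) - A q.1) * (Ψ q.1 * levyKernel N s q.2))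
      ((volume : Measure (EuclideanSpace ℝ (Fin N) × EuclideanSpace ℝ (Fin N))).prod
        (volume.restrict {z | r ≤ ‖z‖})) := by
    refine (hΨi.mul_prod (integrableOn_levyKernel hN hs0 hs2 hr)).bdd_mul (c := 2 * M)
      (by fun_prop) (Eventually.of_forall fun q => ?_)
    rw [Real.norm_eq_abs, abs_le]
    constructor <;> linarith [hA0 (q.1 + (q.2, q.2)), hA1 (q.1 + (q.2, q.2)), hA0 q.1, hA1 q.1]
  -- On `{v y < u x}` the increment of `A` dominates because `A` is at least `u - v`, with equality
  -- at `p`. Elsewhere `A p = 0` and the increments of `A` are nonnegative.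
  have hLle : ∀ p, L p ≤ ∫ z in {z : EuclideanSpace ℝ (Fin N) | r ≤ ‖z‖},
      (A (p + (z, z)) - A p) * levyKernel N s z := by
    intro p
    have hiA : IntegrableOn (fun z => (A (p + (z, z)) - A p) * levyKernel N s z)
        {z | r ≤ ‖z‖} :=
      integrableOn_increment_mul_levyKernel hN hs0 hs2 hr (by fun_prop) (M := 2 * M) fun z => by
        rw [abs_le]
        constructor <;> linarith [hA0 (p + (z, z)), hA1 (p + (z, z)), hA0 p, hA1 p]
    have hle2 : ∀ {a c : ℝ}, |a| ≤ M → |c| ≤ M → |a - c| ≤ 2 * M := fun h1 h2 =>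
      (abs_sub _ _).trans (by linarith)
    have hiu : IntegrableOn (fun z => (u (p.1 + z) - u p.1) * levyKernel N s z) {z | r ≤ ‖z‖} :=
      integrableOn_increment_mul_levyKernel hN hs0 hs2 hr (by fun_prop) (M := 2 * M) fun z =>
        hle2 (hM _) (hM _)
    have hiv : IntegrableOn (fun z => (v (p.2 + z) - v p.2) * levyKernel N s z) {z | r ≤ ‖z‖} :=
      integrableOn_increment_mul_levyKernel hN hs0 hs2 hr (by fun_prop) (M := 2 * M) fun z =>
        hle2 (hM' _) (hM' _)
    by_cases hp : v p.2 < u p.1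
    · have : L p = ∫ z in {z : EuclideanSpace ℝ (Fin N) | r ≤ ‖z‖},
          ((u (p.1 + z) - u p.1) * levyKernel N s z -
            (v (p.2 + z) - v p.2) * levyKernel N s z) := by
        rw [integral_sub hiu hiv]
        simp only [hL, if_pos hp, truncatedOperator]
      rw [this]
      refine integral_mono (hiu.sub hiv) hiA fun z => ?_
      simp only
      rw [← sub_mul]
      refine mul_le_mul_of_nonneg_right ?_ (levyKernel_nonneg z)
      have h1 : A p = u p.1 - v p.2 := max_eq_left (by linarith)
      have h2 : u (p.1 + z) - v (p.2 + z) ≤ A (p + (z, z)) := le_max_left _ _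
      linarith
    · have h1 : A p = 0 := max_eq_right (by linarith)
      simp only [hL, if_neg hp, h1, sub_zero]
      exact integral_nonneg fun z => mul_nonneg (hA0 _) (levyKernel_nonneg z)
  have hmul : ∀ p, (∫ z in {z : EuclideanSpace ℝ (Fin N) | r ≤ ‖z‖},
      (A (p + (z, z)) - A p) * (Ψ p * levyKernel N s z)) =
      (∫ z in {z : EuclideanSpace ℝ (Fin N) | r ≤ ‖z‖},
      (A (p + (z, z)) - A p) * levyKernel N s z) * Ψ p := by
    intro p
    rw [← integral_mul_const]
    congr 1 with z
    ring
  have hstep1 : ∫ p, L p * Ψ p ≤ ∫ p, ∫ z in {z : EuclideanSpace ℝ (Fin N) | r ≤ ‖z‖},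
      (A (p + (z, z)) - A p) * (Ψ p * levyKernel N s z) := by
    refine integral_mono hLi hinc.integral_prod_left fun p => ?_
    simp only [hmul]
    exact mul_le_mul_of_nonneg_right (hLle p) (hΨ0 p)
  -- the increments are moved onto the test function
  have hinv : (volume : Measure
      (EuclideanSpace ℝ (Fin N) × EuclideanSpace ℝ (Fin N))).IsAddRightInvariant := by
    rw [Measure.volume_eq_prod]
    infer_instance
  have hshift : ∀ z : EuclideanSpace ℝ (Fin N), (∫ p, (A (p + (z, z)) - A p) * Ψ p) =
      ∫ p, A p * (Ψ (p - (z, z)) - Ψ p) := by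
    intro z
    have hb : ∀ᵐ p, ‖A p‖ ≤ 2 * M := Eventually.of_forall fun p => by
      rw [Real.norm_of_nonneg (hA0 p)]; exact hA1 p
    have i1 : Integrable fun p => A (p + (z, z)) * Ψ p :=
      hΨi.bdd_mul (c := 2 * M) (hAm.comp (measurable_add_const _)).aestronglyMeasurable
        (Eventually.of_forall fun p => by
        rw [Real.norm_of_nonneg (hA0 _)]; exact hA1 _)
    have i2 : Integrable fun p => A p * Ψ p := hΨi.bdd_mul (c := 2 * M) (by fun_prop) hb
    have i3 : Integrable fun p => A p * Ψ (p - (z, z)) :=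
      (hΨi.comp_sub_right (z, z)).bdd_mul (c := 2 * M) (by fun_prop) hb
    simp only [sub_mul, mul_sub]
    rw [integral_sub i1 i2, integral_sub i3 i2]
    congr 1
    have h := integral_add_right_eq_self (μ := volume) (fun p => A p * Ψ (p - (z, z))) (z, z)
    simpa only [add_sub_cancel_right] using h
  set H : EuclideanSpace ℝ (Fin N) → ℝ := fun z =>
    (∫ p, A p * (Ψ (p - (z, z)) - Ψ p)) * levyKernel N s z with hH
  have hHeq : ∀ z, (∫ p, (A (p + (z, z)) - A p) * (Ψ p * levyKernel N s z)) = H z := by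
    intro z
    rw [hH]
    simp only
    rw [← hshift, ← integral_mul_const]
    congr 1 with p
    ring
  have hHi : IntegrableOn H {z | r ≤ ‖z‖} := by
    refine hinc.integral_prod_right.congr (Eventually.of_forall fun z => ?_)
    exact hHeq z
  have hswap : (∫ p, ∫ z in {z : EuclideanSpace ℝ (Fin N) | r ≤ ‖z‖},
      (A (p + (z, z)) - A p) * (Ψ p * levyKernel N s z)) =
      ∫ z in {z : EuclideanSpace ℝ (Fin N) | r ≤ ‖z‖}, H z := by
    rw [integral_integral_swap hinc]
    simp only [hHeq]
  have hSind : ({z : EuclideanSpace ℝ (Fin N) | r ≤ ‖z‖}.indicator fun z => H (-z)) =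
      fun z => {z : EuclideanSpace ℝ (Fin N) | r ≤ ‖z‖}.indicator H (-z) := by
    ext z
    simp [Set.indicator]
  have hHni : IntegrableOn (fun z => H (-z)) {z | r ≤ ‖z‖} := by
    rw [← integrable_indicator_iff hS, hSind]
    exact ((integrable_indicator_iff hS).2 hHi).comp_neg
  have hHneg : (∫ z in {z : EuclideanSpace ℝ (Fin N) | r ≤ ‖z‖}, H (-z)) =
      ∫ z in {z : EuclideanSpace ℝ (Fin N) | r ≤ ‖z‖}, H z := by
    rw [← integral_indicator hS, hSind, integral_neg_eq_self, integral_indicator hS]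
  set S := ∫ p : EuclideanSpace ℝ (Fin N) × EuclideanSpace ℝ (Fin N), A p * J (p.1 - p.2)
    with hSdef
  have hS0 : 0 ≤ S := integral_nonneg fun p => mul_nonneg (hA0 p) (hJ.nonneg _)
  -- `J (x - y)` is unchanged by a diagonal shift, so adding the contributions of `z` and `-z`
  -- produces the second difference of `φ` alone, times `A * J`.
  have hHle : ∀ z, H z + H (-z) ≤ m z * levyKernel N s z * S := by
    intro z
    have hb : ∀ᵐ p, ‖A p‖ ≤ 2 * M := Eventually.of_forall fun p => by
      rw [Real.norm_of_nonneg (hA0 p)]; exact hA1 p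
    have i : ∀ z, Integrable fun p => A p * (Ψ (p - (z, z)) - Ψ p) := fun z =>
      ((hΨi.comp_sub_right (z, z)).sub hΨi).bdd_mul (c := 2 * M) (by fun_prop) hb
    simp only [hH]
    rw [levyKernel_neg, ← add_mul, ← integral_add (i z) (i (-z)), mul_right_comm]
    refine mul_le_mul_of_nonneg_right ?_ (levyKernel_nonneg z)
    rw [hSdef, ← integral_const_mul]
    refine integral_mono ((i z).add (i (-z))) (hAJ.const_mul _) fun p => ?_
    have h1 := hm p.1 z
    have h2 := mul_nonneg (hA0 p) (hJ.nonneg (p.1 - p.2))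
    have h3 := mul_le_mul_of_nonneg_right h1 h2
    simp only [hΨ, Prod.fst_sub, Prod.snd_sub, sub_neg_eq_add, sub_sub_sub_cancel_right,
      add_sub_add_right_eq_sub]
    linarith
  -- The kernel and the domain are even, so the integral of `H` is half that of `H z + H (-z)`; this
  -- is the source of the factor `1 / 2`.
  have hfinal : 2 * ∫ z in {z : EuclideanSpace ℝ (Fin N) | r ≤ ‖z‖}, H z ≤
      (∫ z, m z * levyKernel N s z) * S := by
    rw [two_mul]
    nth_rewrite 2 [← hHneg]
    rw [← integral_add hHi hHni, ← integral_mul_const]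
    refine (integral_mono (hHi.add hHni) (hmi.mul_const S).integrableOn hHle).trans ?_
    exact setIntegral_le_integral (hmi.mul_const S) (Eventually.of_forall fun z =>
      mul_nonneg (mul_nonneg (hm0 z) (levyKernel_nonneg z)) hS0)
  rw [hswap] at hstep1
  linarith

end Nonlocal

/-! ### The limit `r → 0` and the comparison estimate. -/

section Comparison

variable {N : ℕ} {s : ℝ} {b : ℝ → ℝ} {F : ℝ → EuclideanSpace ℝ (Fin N)}

lemma integrable_posPart_sub_mul_doubled {g g' φ J : EuclideanSpace ℝ (Fin N) → ℝ} {R R' : ℝ}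
    (hg : Integrable g) (hg' : Integrable g') (hgm : Measurable g) (hgm' : Measurable g')
    (hφ : IsCutoff φ R) (hJ : IsCutoff J R') :
    Integrable fun p : EuclideanSpace ℝ (Fin N) × EuclideanSpace ℝ (Fin N) =>
      max (g p.1 - g' p.2) 0 * (φ p.1 * J (p.1 - p.2)) := by
  obtain ⟨C, hC⟩ := hφ.exists_bound
  have hφm := hφ.contDiff.continuous.measurable
  refine ((integrable_posPart_sub_mul hg hg' hgm hgm' hJ).bdd_mul (c := C)
    (f := fun p => φ p.1) (hφm.comp measurable_fst).aestronglyMeasurable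
    (Eventually.of_forall fun p => ?_)).congr
      (Eventually.of_forall fun p => ?_)
  · rw [Real.norm_of_nonneg (hφ.nonneg _)]
    exact hC _
  · simp only
    ring

/-- The comparison estimate at fixed mollification and cutoff. -/
theorem doubled_comparison (hN : 1 ≤ N) (hs0 : 0 < s) (hs1 : s ≤ 1)
    (hb : Continuous b) (hbMono : Monotone b) (hF : LocallyLipschitz F)
    {f f' u v : EuclideanSpace ℝ (Fin N) → ℝ}
    (h : IsEntropySolution s b F f u) (h' : IsEntropySolution s b F f' v)
    (hf : Integrable f) (hfm : Measurable f) (hf' : Integrable f') (hfm' : Measurable f')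
    (hu : Measurable u) (hv : Measurable v) (hui : Integrable u) (hvi : Integrable v)
    (hbu : Integrable fun x => b (u x)) (hbv : Integrable fun x => b (v x))
    {M : ℝ} (hM : ∀ x, |u x| ≤ M) (hM' : ∀ x, |v x| ≤ M)
    {K : NNReal} (hK : LipschitzOnWith K F (Set.Icc (-M) M))
    {φ J : EuclideanSpace ℝ (Fin N) → ℝ} {R R' : ℝ} (hR' : 0 ≤ R') (hφ : IsCutoff φ R)
    (hJ : IsCutoff J R') (hJ1 : ∫ z, J z = 1)
    {D : ℝ} (hD : ∀ x, ‖fderiv ℝ φ x‖ ≤ D)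
    {m : EuclideanSpace ℝ (Fin N) → ℝ}
    (hm : ∀ x z, φ (x - z) + φ (x + z) - 2 * φ x ≤ m z) (hm0 : ∀ z, 0 ≤ m z)
    (hmi : Integrable fun z => m z * levyKernel N s z) :
    ∫ p : EuclideanSpace ℝ (Fin N) × EuclideanSpace ℝ (Fin N),
      max (b (u p.1) - b (v p.2)) 0 * (φ p.1 * J (p.1 - p.2)) ≤
    (∫ p : EuclideanSpace ℝ (Fin N) × EuclideanSpace ℝ (Fin N),
      max (f p.1 - f' p.2) 0 * (φ p.1 * J (p.1 - p.2))) +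
    (fracLapConst N s * (1 / 2 * ∫ z, m z * levyKernel N s z) + D * K) *
      ((∫ x, |u x|) + ∫ x, |v x|) := by
  have hs2 : s < 2 := by linarith
  have hc0 := fracLapConst_nonneg (N := N) hs0 hs1
  obtain ⟨C, hC⟩ := exists_doubled_inequality hN hs0 hs1 hb hF h h' hf hfm hf' hfm' hu hv hM hM'
    hR' hφ hJ
  set c := fracLapConst N s with hc
  have hD0 : 0 ≤ D := (norm_nonneg _).trans (hD 0)
  have hI : 0 ≤ ∫ z, m z * levyKernel N s z :=
    integral_nonneg fun z => mul_nonneg (hm0 z) (levyKernel_nonneg z)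
  have hSle := integral_posPart_sub_mul_le hui hvi hu hv hJ hJ1
  have hSi := integrable_posPart_sub_mul hui hvi hu hv hJ
  set S := ∫ p : EuclideanSpace ℝ (Fin N) × EuclideanSpace ℝ (Fin N),
    max (u p.1 - v p.2) 0 * J (p.1 - p.2) with hS
  have hfi := integrable_posPart_sub_mul_doubled hf hf' hfm hfm' hφ hJ
  have hbi := integrable_posPart_sub_mul_doubled hbu hbv (hb.measurable.comp hu)
    (hb.measurable.comp hv) hφ hJ
  have hr : ∀ r : ℝ, 0 < r → r ≤ 1 →
      ∫ p : EuclideanSpace ℝ (Fin N) × EuclideanSpace ℝ (Fin N),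
        max (b (u p.1) - b (v p.2)) 0 * (φ p.1 * J (p.1 - p.2)) ≤
      (∫ p : EuclideanSpace ℝ (Fin N) × EuclideanSpace ℝ (Fin N),
        max (f p.1 - f' p.2) 0 * (φ p.1 * J (p.1 - p.2))) +
        (c * (1 / 2 * ∫ z, m z * levyKernel N s z) + D * K) * S +
        C * ∫ z in {z : EuclideanSpace ℝ (Fin N) | ‖z‖ ≤ r}, ‖z‖ ^ 2 * levyKernel N s z := by
    intro r hr0 hr1
    obtain ⟨hint, hineq⟩ := hC r hr0 hr1
    obtain ⟨hLi, hLle⟩ := integral_truncatedOperator_doubled_le hN hs0 hs2 hu hv hui hvi hM hM'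
      hφ hJ hm hm0 hmi hr0
    -- On `{v y < u x}` monotonicity of `b` turns `b u - b v` into its positive part, and the flux
    -- term is at most `D * K * (u - v)`. Off this set the doubled integrand and `(b u - b v)⁺` both
    -- vanish, and the other terms are nonnegative or zero.
    have hmono := integral_mono hint
      ((hfi.sub hbi).add ((hLi.const_mul c).add (hSi.const_mul (D * K)))) fun p => by
        have hφ0 := hφ.nonneg p.1
        have hJ0 := hJ.nonneg (p.1 - p.2)
        have hΨ0 := mul_nonneg hφ0 hJ0
        have h1 : 0 ≤ max (f p.1 - f' p.2) 0 := le_max_right _ _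
        simp only [doubledIntegrand, Pi.add_apply, Pi.sub_apply]
        split_ifs with hp
        · have h2 : max (b (u p.1) - b (v p.2)) 0 = b (u p.1) - b (v p.2) :=
            max_eq_left (sub_nonneg.2 (hbMono hp.le))
          have h3 : max (u p.1 - v p.2) 0 = u p.1 - v p.2 := max_eq_left (by linarith)
          have h4 : fderiv ℝ φ p.1 (F (u p.1) - F (v p.2)) ≤ D * (K * (u p.1 - v p.2)) := by
            refine (le_abs_self _).trans (((fderiv ℝ φ p.1).le_opNorm _).trans ?_)
            gcongr
            · exact hD _
            · rw [← dist_eq_norm]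
              refine (hK.dist_le_mul _ (abs_le.1 (hM _)) _ (abs_le.1 (hM' _))).trans ?_
              rw [Real.dist_eq, abs_of_nonneg (by linarith)]
          have h5 := mul_le_mul_of_nonneg_left h4 hJ0
          have h6 := mul_le_mul_of_nonneg_right (le_max_left (f p.1 - f' p.2) 0) hΨ0
          rw [h2, h3]
          linarith
        · have h2 : max (b (u p.1) - b (v p.2)) 0 = 0 :=
            max_eq_right (sub_nonpos.2 (hbMono (not_lt.1 hp)))
          have h3 : 0 ≤ max (u p.1 - v p.2) 0 := le_max_right _ _
          rw [h2]
          have : 0 ≤ D * K * (max (u p.1 - v p.2) 0 * J (p.1 - p.2)) := by positivity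
          have := mul_nonneg h1 hΨ0
          linarith
    rw [integral_add' (hfi.sub hbi) ((hLi.const_mul c).add (hSi.const_mul (D * K))),
      integral_sub' hfi hbi, integral_add' (hLi.const_mul c) (hSi.const_mul (D * K)),
      integral_const_mul, integral_const_mul] at hmono
    have h7 := mul_le_mul_of_nonneg_left hLle hc0
    linarith
  have hlim := ((tendsto_setIntegral_sq_mul_levyKernel hN hs0 hs2).const_mul C).const_add
    ((∫ p : EuclideanSpace ℝ (Fin N) × EuclideanSpace ℝ (Fin N),
        max (f p.1 - f' p.2) 0 * (φ p.1 * J (p.1 - p.2))) +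
        (c * (1 / 2 * ∫ z, m z * levyKernel N s z) + D * K) * S)
  have hlim2 := ge_of_tendsto' hlim fun n => hr (1 / ((n : ℝ) + 1)) Nat.one_div_pos_of_nat
    (by rw [div_le_one (by positivity)]; simp)
  rw [mul_zero, add_zero] at hlim2
  refine hlim2.trans ?_
  gcongr

end Comparison

/-! ### Removal of the mollifier. -/

section Mollification

variable {N : ℕ}

lemma exists_mollifier {δ : ℝ} (hδ : 0 < δ) :
    ∃ J : EuclideanSpace ℝ (Fin N) → ℝ, IsCutoff J δ ∧ ∫ z, J z = 1 := by
  let β : ContDiffBump (0 : EuclideanSpace ℝ (Fin N)) :=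
    { rIn := δ / 2, rOut := δ, rIn_pos := half_pos hδ, rIn_lt_rOut := half_lt_self hδ }
  refine ⟨β.normed volume, ⟨β.contDiff_normed, fun x => β.nonneg_normed x, fun x hx => ?_⟩,
    β.integral_normed⟩
  have : x ∉ Function.support (β.normed volume) := by
    rw [β.support_normed_eq]
    simpa using hx.le
  simpa using this

lemma integrable_abs_sub_mul {g J : EuclideanSpace ℝ (Fin N) → ℝ} {δ : ℝ} (hg : Integrable g)
    (hJ : IsCutoff J δ) :
    Integrable fun p : EuclideanSpace ℝ (Fin N) × EuclideanSpace ℝ (Fin N) =>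
      |g p.1 - g p.2| * J (p.1 - p.2) := by
  refine ((integrable_fst_mul_sub hg hJ.integrable).sub
    (integrable_snd_mul_sub hg hJ.integrable)).abs.congr (Eventually.of_forall fun p => ?_)
  simp only [Pi.sub_apply]
  rw [← sub_mul, abs_mul, abs_of_nonneg (hJ.nonneg _)]

/-- Mollification does not move an integrable function much in the mean. -/
lemma exists_integral_abs_sub_mul_le {g : EuclideanSpace ℝ (Fin N) → ℝ} (hg : Integrable g)
    {ε : ℝ} (hε : 0 < ε) :
    ∃ δ : ℝ, 0 < δ ∧ ∀ (δ' : ℝ) (J : EuclideanSpace ℝ (Fin N) → ℝ), δ' ≤ δ → IsCutoff J δ' →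
      ∫ z, J z = 1 →
      ∫ p : EuclideanSpace ℝ (Fin N) × EuclideanSpace ℝ (Fin N),
        |g p.1 - g p.2| * J (p.1 - p.2) ≤ ε := by
  -- The error `‖g - k‖₁ ≤ ε / 4` is paid twice, at `x` and at `y`; the remaining `ε / 2` is for the
  -- oscillation of `k` over a ball of volume `V`.
  obtain ⟨k, hkc, hkε, hk, hki⟩ :=
    hg.exists_hasCompactSupport_integral_sub_le (ε := ε / 4) (by positivity)
  obtain ⟨ρ, hρ⟩ : ∃ ρ, ∀ x, ρ < ‖x‖ → k x = 0 := by
    obtain ⟨ρ, hρ⟩ := (hkc.isCompact.isBounded).subset_closedBall 0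
    refine ⟨ρ, fun x hx => ?_⟩
    by_contra hne
    have := hρ (subset_tsupport k hne)
    simp at this
    linarith
  set V := volume.real (Metric.closedBall (0 : EuclideanSpace ℝ (Fin N)) (ρ + 1))
  have hV0 : 0 ≤ V := measureReal_nonneg
  obtain ⟨δ, hδ, hδk⟩ := Metric.uniformContinuous_iff.1
    (hkc.uniformContinuous_of_continuous hk) (ε / (2 * (V + 1))) (by positivity)
  -- Half of `δ` gives the strict inequality of uniform continuity; the bound `1` keeps both points
  -- off the support of `k` once `p.1` leaves the ball of radius `ρ + 1`.
  refine ⟨min (δ / 2) 1, by positivity, fun δ' J hδ' hJ hJ1 => ?_⟩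
  have hball : MeasurableSet (Metric.closedBall (0 : EuclideanSpace ℝ (Fin N)) (ρ + 1)) :=
    Metric.isClosed_closedBall.measurableSet
  set E₀ := (Metric.closedBall (0 : EuclideanSpace ℝ (Fin N)) (ρ + 1)).indicator
    fun _ => ε / (2 * (V + 1))
  have hE₀ : Integrable E₀ := (integrable_indicator_iff hball).2
      (integrableOn_const (isCompact_closedBall _ _).measure_lt_top.ne)
  have hE₀int : ∫ y, E₀ y = V * (ε / (2 * (V + 1))) := by
    rw [integral_indicator hball, setIntegral_const, smul_eq_mul]
  have hd : Integrable fun x => |g x - k x| := (hg.sub hki).abs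
  have hi1 := integrable_fst_mul_sub hd hJ.integrable
  have hi2 := integrable_snd_mul_sub hd hJ.integrable
  have hi3 := integrable_fst_mul_sub hE₀ hJ.integrable
  have hle := integral_mono (integrable_abs_sub_mul hg hJ) ((hi1.add hi2).add hi3) fun p => by
    have hJ0 := hJ.nonneg (p.1 - p.2)
    simp only [Pi.add_apply, ← add_mul]
    rcases lt_or_ge δ' ‖p.1 - p.2‖ with hfar | hnear
    · rw [hJ.eq_zero _ hfar, mul_zero, mul_zero]
    · refine mul_le_mul_of_nonneg_right ?_ hJ0
      have hk1 : |k p.1 - k p.2| ≤ E₀ p.1 := by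
        by_cases hp : p.1 ∈ Metric.closedBall (0 : EuclideanSpace ℝ (Fin N)) (ρ + 1)
        · simp only [E₀, Set.indicator_of_mem hp]
          have : dist p.1 p.2 < δ := by
            rw [dist_eq_norm]
            linarith [min_le_left (δ / 2) 1]
          exact (hδk this).le
        · simp only [E₀, Set.indicator_of_notMem hp]
          have hp' : ρ + 1 < ‖p.1‖ := by simpa using hp
          have h2 : ρ < ‖p.2‖ := by
            have := norm_sub_norm_le p.1 p.2
            linarith [min_le_right (δ / 2) 1]
          rw [hρ _ h2, hρ p.1 (by linarith)]
          simp
      calc |g p.1 - g p.2| = |(g p.1 - k p.1) - (g p.2 - k p.2) + (k p.1 - k p.2)| := by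
            congr 1; ring
        _ ≤ |g p.1 - k p.1| + |g p.2 - k p.2| + |k p.1 - k p.2| :=
            (abs_add_le _ _).trans (by gcongr; exact abs_sub _ _)
        _ ≤ _ := by gcongr
  rw [integral_add' (hi1.add hi2) hi3, integral_add' hi1 hi2, integral_fst_mul_sub hd hJ.integrable,
    integral_snd_mul_sub hd hJ.integrable, integral_fst_mul_sub hE₀ hJ.integrable, hJ1, hE₀int]
    at hle
  have hVle : V * (ε / (2 * (V + 1))) ≤ ε / 2 := by
    rw [mul_div_assoc', div_le_div_iff₀ (by positivity) (by positivity)]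
    nlinarith
  simp only [Real.norm_eq_abs] at hkε
  linarith

/-- Removing the mollifier from a doubled integral. -/
lemma abs_integral_doubled_sub_le {g g' φ J : EuclideanSpace ℝ (Fin N) → ℝ} {R δ : ℝ}
    (hg : Integrable g) (hg' : Integrable g') (hgm : Measurable g) (hgm' : Measurable g')
    (hφ : IsCutoff φ R) (hφ1 : ∀ x, φ x ≤ 1) (hJ : IsCutoff J δ) (hJ1 : ∫ z, J z = 1) :
    |(∫ p : EuclideanSpace ℝ (Fin N) × EuclideanSpace ℝ (Fin N),
      max (g p.1 - g' p.2) 0 * (φ p.1 * J (p.1 - p.2))) - ∫ x, max (g x - g' x) 0 * φ x| ≤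
    ∫ p : EuclideanSpace ℝ (Fin N) × EuclideanSpace ℝ (Fin N),
      |g' p.1 - g' p.2| * J (p.1 - p.2) := by
  have hd : Integrable fun x => max (g x - g' x) 0 * φ x :=
    (hg.sub hg').pos_part.mul_bdd (c := 1) hφ.contDiff.continuous.aestronglyMeasurable
      (Eventually.of_forall fun x => by rw [Real.norm_of_nonneg (hφ.nonneg x)]; exact hφ1 x)
  have h1 := integral_fst_mul_sub hd hJ.integrable
  rw [hJ1, mul_one] at h1
  rw [← h1, ← integral_sub (integrable_posPart_sub_mul_doubled hg hg' hgm hgm' hφ hJ)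
    (integrable_fst_mul_sub hd hJ.integrable)]
  refine (Real.norm_eq_abs _).ge.trans (norm_integral_le_of_norm_le (integrable_abs_sub_mul hg' hJ)
    (Eventually.of_forall fun p => ?_))
  have hJ0 := hJ.nonneg (p.1 - p.2)
  rw [← mul_assoc, ← sub_mul, ← sub_mul, norm_mul, norm_mul, Real.norm_of_nonneg hJ0,
    Real.norm_of_nonneg (hφ.nonneg p.1), Real.norm_eq_abs]
  refine mul_le_mul_of_nonneg_right ?_ hJ0
  refine (mul_le_of_le_one_right (abs_nonneg _) (hφ1 _)).trans ?_
  refine (abs_max_sub_max_le_abs _ _ _).trans (le_of_eq ?_)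
  congr 1
  ring

end Mollification

/-! ### Cutoffs exhausting the space. -/

section Cutoffs

variable {N : ℕ} {s : ℝ}

/-- Smooth cutoffs exhausting the space, whose first derivatives and whose nonlocal second
differences tend to zero. -/
lemma exists_cutoff_sequence (hN : 1 ≤ N) (hs0 : 0 < s) (hs2 : s < 2) :
    ∃ (φ m : ℕ → EuclideanSpace ℝ (Fin N) → ℝ) (R D : ℕ → ℝ),
      (∀ n, IsCutoff (φ n) (R n)) ∧ (∀ n x, φ n x ≤ 1) ∧
      (∀ x, Tendsto (fun n => φ n x) atTop (𝓝 1)) ∧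
      (∀ n x, ‖fderiv ℝ (φ n) x‖ ≤ D n) ∧ Tendsto D atTop (𝓝 0) ∧
      (∀ n x z, φ n (x - z) + φ n (x + z) - 2 * φ n x ≤ m n z) ∧ (∀ n z, 0 ≤ m n z) ∧
      (∀ n, Integrable fun z => m n z * levyKernel N s z) ∧
      Tendsto (fun n => ∫ z, m n z * levyKernel N s z) atTop (𝓝 0) := by
  let β : ContDiffBump (0 : EuclideanSpace ℝ (Fin N)) :=
    { rIn := 1, rOut := 2, rIn_pos := one_pos, rIn_lt_rOut := one_lt_two }
  have hβ : ContDiff ℝ ∞ β := β.contDiff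
  obtain ⟨B, hB0, hB⟩ := exists_taylor_bound hβ β.hasCompactSupport
  obtain ⟨K, hK⟩ := ContDiff.lipschitzWith_of_hasCompactSupport (n := ∞) β.hasCompactSupport hβ
    (by simp)
  have hpos : ∀ n : ℕ, (0 : ℝ) < (n : ℝ) + 1 := fun n => by positivity
  set a : ℕ → ℝ := fun n => 1 / ((n : ℝ) + 1) with ha
  have ha0 : ∀ n, 0 < a n := fun n => one_div_pos.2 (hpos n)
  have ha1 : ∀ n, a n ≤ 1 := fun n => by
    rw [ha]
    simp only
    rw [div_le_one (hpos n)]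
    simp
  have halim : Tendsto a atTop (𝓝 0) := tendsto_one_div_add_atTop_nhds_zero_nat
  set φ : ℕ → EuclideanSpace ℝ (Fin N) → ℝ := fun n x => β (a n • x) with hφ
  -- The bound `2` comes from `0 ≤ φ ≤ 1`. The other one adds the Taylor bounds for the increments
  -- `z` and `-z`, whose linear terms cancel. Since `a n ≤ 1`, both are controlled by `min 1 (‖z‖ ^
  -- 2)`, which makes dominated convergence available.
  set m : ℕ → EuclideanSpace ℝ (Fin N) → ℝ := fun n z => min 2 (2 * B * (a n * ‖z‖) ^ 2) with hm
  have hm0 : ∀ n z, 0 ≤ m n z := fun n z => le_min zero_le_two (by positivity)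
  have hmle : ∀ n z, m n z ≤ (2 + 2 * B) * min 1 (‖z‖ ^ 2) := by
    intro n z
    have h1 : (a n * ‖z‖) ^ 2 ≤ ‖z‖ ^ 2 := by
      refine pow_le_pow_left₀ (mul_nonneg (ha0 n).le (norm_nonneg z)) ?_ 2
      exact mul_le_of_le_one_left (norm_nonneg z) (ha1 n)
    rw [mul_min_of_nonneg _ _ (by positivity)]
    refine le_min ((min_le_left _ _).trans (by linarith)) ((min_le_right _ _).trans ?_)
    nlinarith [sq_nonneg ‖z‖]
  have hmm : ∀ n, Measurable (m n) := fun n => by fun_prop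
  have hwm := measurable_levyKernel (N := N) (s := s)
  have hdom : Integrable fun z => (2 + 2 * B) * (min 1 (‖z‖ ^ 2) * levyKernel N s z) :=
    (integrable_min_one_sq_mul_levyKernel hN hs0 hs2).const_mul _
  have hbd : ∀ n z, ‖m n z * levyKernel N s z‖ ≤
      (2 + 2 * B) * (min 1 (‖z‖ ^ 2) * levyKernel N s z) := by
    intro n z
    rw [Real.norm_of_nonneg (mul_nonneg (hm0 n z) (levyKernel_nonneg z)), ← mul_assoc]
    exact mul_le_mul_of_nonneg_right (hmle n z) (levyKernel_nonneg z)
  refine ⟨φ, m, fun n => 2 * ((n : ℝ) + 1), fun n => K * a n, fun n => ⟨?_, fun x => β.nonneg, ?_⟩,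
    fun n x => β.le_one, fun x => ?_, fun n x => ?_, ?_, fun n x z => le_min ?_ ?_, hm0, fun n => ?_,
    ?_⟩
  · exact hβ.comp (contDiff_const_smul _)
  · intro x hx
    refine β.zero_of_le_dist ?_
    rw [dist_zero_right, norm_smul, Real.norm_of_nonneg (ha0 n).le, ha, one_div_mul_eq_div,
      le_div_iff₀ (hpos n)]
    exact hx.le
  · refine tendsto_const_nhds.congr' ?_
    obtain ⟨k, hk⟩ := exists_nat_gt ‖x‖
    filter_upwards [eventually_ge_atTop k] with n hn
    refine (β.one_of_mem_closedBall ?_).symm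
    rw [mem_closedBall_zero_iff, norm_smul, Real.norm_of_nonneg (ha0 n).le, ha,
      one_div_mul_eq_div, div_le_iff₀ (hpos n)]
    have : (k : ℝ) ≤ n := by exact_mod_cast hn
    change ‖x‖ ≤ 1 * ((n : ℝ) + 1)
    linarith
  · have h : LipschitzWith (K * (a n).toNNReal) (φ n) := by
      refine LipschitzWith.of_dist_le_mul fun x y => ?_
      refine (hK.dist_le_mul _ _).trans (le_of_eq ?_)
      rw [dist_smul₀, Real.norm_of_nonneg (ha0 n).le, NNReal.coe_mul,
        Real.coe_toNNReal _ (ha0 n).le, mul_assoc]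
    simpa [(ha0 n).le] using norm_fderiv_le_of_lipschitz ℝ h (x₀ := x)
  · simpa using halim.const_mul (K : ℝ)
  · have h1 := β.le_one (x := a n • (x - z))
    have h2 := β.le_one (x := a n • (x + z))
    have h3 := β.nonneg (x := a n • x)
    simp only [hφ]
    linarith
  · have h1 := le_trans (le_abs_self _) (hB (a n • x) (a n • z))
    have h2 := le_trans (le_abs_self _) (hB (a n • x) (-(a n • z)))
    rw [map_neg, norm_neg] at h2
    rw [norm_smul, Real.norm_of_nonneg (ha0 n).le] at h1 h2
    simp only [hφ, smul_sub, smul_add]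
    rw [← sub_eq_add_neg] at h2
    linarith
  · exact hdom.mono' (by fun_prop) (Eventually.of_forall (hbd n))
  · rw [← integral_zero (EuclideanSpace ℝ (Fin N)) ℝ (μ := volume)]
    refine tendsto_integral_of_dominated_convergence _ (fun n => ?_) hdom
      (fun n => Eventually.of_forall (hbd n)) (Eventually.of_forall fun z => ?_)
    · exact ((hmm n).mul hwm).aestronglyMeasurable
    · have h1 : Tendsto (fun n => 2 * B * (a n * ‖z‖) ^ 2) atTop (𝓝 0) := by
        simpa using ((halim.mul_const ‖z‖).pow 2).const_mul (2 * B)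
      have h2 := squeeze_zero (fun n => hm0 n z) (fun n => min_le_right _ _) h1
      simpa using h2.mul_const (levyKernel N s z)

end Cutoffs

/-! ### Removal of the cutoff and conclusion. -/

section Main

variable {N : ℕ} {s : ℝ} {b : ℝ → ℝ} {F : ℝ → EuclideanSpace ℝ (Fin N)}

/-- The error `e n` depends on the cutoff but not on the mollifier. At fixed `n` a mollifier fine
enough for both `f'` and `b v` costs at most `ε`; afterwards `n → ∞`, by dominated convergence on
the left and `e n → 0` on the right. -/
theorem IsEntropySolution.integral_posPart_le_of_measurable (hN : 1 ≤ N) (hs0 : 0 < s)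
    (hs1 : s ≤ 1) (hb : Continuous b) (hbMono : Monotone b) (hF : LocallyLipschitz F)
    {f f' u v : EuclideanSpace ℝ (Fin N) → ℝ}
    (h : IsEntropySolution s b F f u) (h' : IsEntropySolution s b F f' v)
    (hf : Integrable f) (hfm : Measurable f) (hf' : Integrable f') (hfm' : Measurable f')
    (hu : Measurable u) (hv : Measurable v) (hui : Integrable u) (hvi : Integrable v)
    (hbu : Integrable fun x => b (u x)) (hbv : Integrable fun x => b (v x))
    {M : ℝ} (hM : ∀ x, |u x| ≤ M) (hM' : ∀ x, |v x| ≤ M) :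
    ∫ x, max (b (u x) - b (v x)) 0 ≤ ∫ x, max (f x - f' x) 0 := by
  have hs2 : s < 2 := by linarith
  obtain ⟨K, hK⟩ := hF.locallyLipschitzOn.exists_lipschitzOnWith_of_compact
    (s := Set.Icc (-M) M) isCompact_Icc
  obtain ⟨φ, m, R, D, hφ, hφ1, hφlim, hD, hDlim, hm, hm0, hmi, hmlim⟩ :=
    exists_cutoff_sequence hN hs0 hs2
  have hbum := hb.measurable.comp hu
  have hbvm := hb.measurable.comp hv
  set e : ℕ → ℝ := fun n => (fracLapConst N s * (1 / 2 * ∫ z, m n z * levyKernel N s z) + D n * K) *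
    ((∫ x, |u x|) + ∫ x, |v x|)
  have he : Tendsto e atTop (𝓝 0) := by
    simpa using (((hmlim.const_mul (1 / 2)).const_mul (fracLapConst N s)).add
      (hDlim.mul_const (K : ℝ))).mul_const ((∫ x, |u x|) + ∫ x, |v x|)
  have hfp : Integrable fun x => max (f x - f' x) 0 := (hf.sub hf').pos_part
  have hbp : Integrable fun x => max (b (u x) - b (v x)) 0 := (hbu.sub hbv).pos_part
  have hstep : ∀ n, ∫ x, max (b (u x) - b (v x)) 0 * φ n x ≤
      (∫ x, max (f x - f' x) 0) + e n := by
    intro n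
    refine le_of_forall_pos_le_add fun ε hε => ?_
    obtain ⟨δ₁, hδ₁, h₁⟩ := exists_integral_abs_sub_mul_le hf' (half_pos hε)
    obtain ⟨δ₂, hδ₂, h₂⟩ := exists_integral_abs_sub_mul_le hbv (half_pos hε)
    obtain ⟨J, hJ, hJ1⟩ := exists_mollifier (N := N) (lt_min hδ₁ hδ₂)
    have k₁ := h₁ _ J (min_le_left _ _) hJ hJ1
    have k₂ := h₂ _ J (min_le_right _ _) hJ hJ1
    have k₃ := doubled_comparison hN hs0 hs1 hb hbMono hF h h' hf hfm hf' hfm' hu hv hui hvi hbu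
      hbv hM hM' hK (lt_min hδ₁ hδ₂).le (hφ n) hJ hJ1 (hD n) (hm n) (hm0 n) (hmi n)
    have k₄ := abs_le.1 (abs_integral_doubled_sub_le hf hf' hfm hfm' (hφ n) (hφ1 n) hJ hJ1)
    have k₅ := abs_le.1 (abs_integral_doubled_sub_le hbu hbv hbum hbvm (hφ n) (hφ1 n) hJ hJ1)
    have k₆ : ∫ x, max (f x - f' x) 0 * φ n x ≤ ∫ x, max (f x - f' x) 0 := by
      refine integral_mono_of_nonneg (Eventually.of_forall fun x =>
        mul_nonneg (le_max_right _ _) ((hφ n).nonneg x)) hfp (Eventually.of_forall fun x => ?_)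
      exact mul_le_of_le_one_right (le_max_right _ _) (hφ1 n x)
    simp only [e]
    linarith [k₄.2, k₅.1]
  have hlim : Tendsto (fun n => ∫ x, max (b (u x) - b (v x)) 0 * φ n x) atTop
      (𝓝 (∫ x, max (b (u x) - b (v x)) 0)) := by
    refine tendsto_integral_of_dominated_convergence _ (fun n => ?_) hbp
      (fun n => Eventually.of_forall fun x => ?_) (Eventually.of_forall fun x => ?_)
    · exact hbp.1.mul (hφ n).contDiff.continuous.aestronglyMeasurable
    · rw [Real.norm_of_nonneg (mul_nonneg (le_max_right _ _) ((hφ n).nonneg x))]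
      exact mul_le_of_le_one_right (le_max_right _ _) (hφ1 n x)
    · simpa using (hφlim x).const_mul (max (b (u x) - b (v x)) 0)
  have hlim2 := he.const_add (∫ x, max (f x - f' x) 0)
  rw [add_zero] at hlim2
  exact le_of_tendsto_of_tendsto' hlim hlim2 hstep

/-- Dividing the growth condition by `|t|` gives `lam * |t| ≤ |b t|`. Integrability of the solutions
is what makes the cutoff error finite. -/
lemma integrable_of_integrable_comp {lam : ℝ} (hlam : 0 < lam)
    (hb : ∀ t : ℝ, lam * |t| ^ 2 ≤ b t * t) {u : EuclideanSpace ℝ (Fin N) → ℝ}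
    (hu : Measurable u) (hbu : Integrable fun x => b (u x)) : Integrable u := by
  refine (hbu.norm.const_mul lam⁻¹).mono' hu.aestronglyMeasurable (Eventually.of_forall fun x => ?_)
  have h1 : lam * |u x| ^ 2 ≤ |b (u x)| * |u x| := by
    rw [← abs_mul]
    exact (hb (u x)).trans (le_abs_self _)
  rw [Real.norm_eq_abs, Real.norm_eq_abs, inv_mul_eq_div, le_div_iff₀ hlam]
  rcases (abs_nonneg (u x)).eq_or_lt with h0 | h0
  · rw [← h0, zero_mul]
    exact abs_nonneg _
  · refine le_of_mul_le_mul_right ?_ h0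
    linarith

theorem IsEntropySolution.integral_posPart_le (hN : 1 ≤ N) (hs0 : 0 < s)
    (hs1 : s ≤ 1) (hb : Continuous b) (hbMono : Monotone b)
    (hbGrowth : ∃ lam : ℝ, 0 < lam ∧ ∀ t : ℝ, lam * |t| ^ 2 ≤ b t * t) (hF : LocallyLipschitz F)
    {f f' u v : EuclideanSpace ℝ (Fin N) → ℝ}
    (h : IsEntropySolution s b F f u) (h' : IsEntropySolution s b F f' v)
    (hf : Integrable f) (hf' : Integrable f')
    (hbu : Integrable fun x => b (u x)) (hbv : Integrable fun x => b (v x)) :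
    ∫ x, max (b (u x) - b (v x)) 0 ≤ ∫ x, max (f x - f' x) 0 := by
  obtain ⟨lam, hlam, hgrowth⟩ := hbGrowth
  obtain ⟨u₁, hu₁, ⟨M, hM⟩, huu⟩ := exists_measurable_bounded_representative h.memLp_top
  obtain ⟨v₁, hv₁, ⟨M', hM'⟩, hvv⟩ := exists_measurable_bounded_representative h'.memLp_top
  set f₁ := hf.1.mk f
  set f₁' := hf'.1.mk f'
  have hff : f =ᵐ[volume] f₁ := hf.1.ae_eq_mk
  have hff' : f' =ᵐ[volume] f₁' := hf'.1.ae_eq_mk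
  have hbuu : (fun x => b (u x)) =ᵐ[volume] fun x => b (u₁ x) := huu.fun_comp b
  have hbvv : (fun x => b (v x)) =ᵐ[volume] fun x => b (v₁ x) := hvv.fun_comp b
  have hbu₁ := hbu.congr hbuu
  have hbv₁ := hbv.congr hbvv
  have key := (h.congr_ae hff huu).integral_posPart_le_of_measurable hN hs0 hs1 hb hbMono hF
    (h'.congr_ae hff' hvv) (hf.congr hff) hf.1.stronglyMeasurable_mk.measurable (hf'.congr hff')
    hf'.1.stronglyMeasurable_mk.measurable hu₁ hv₁
    (integrable_of_integrable_comp hlam hgrowth hu₁ hbu₁)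
    (integrable_of_integrable_comp hlam hgrowth hv₁ hbv₁) hbu₁ hbv₁
    (M := max M M') (fun x => (hM x).trans (le_max_left _ _))
    (fun x => (hM' x).trans (le_max_right _ _))
  have e₁ : ∫ x, max (b (u x) - b (v x)) 0 = ∫ x, max (b (u₁ x) - b (v₁ x)) 0 := by
    refine integral_congr_ae ?_
    filter_upwards [huu, hvv] with x h1 h2
    rw [h1, h2]
  have e₂ : ∫ x, max (f x - f' x) 0 = ∫ x, max (f₁ x - f₁' x) 0 := by
    refine integral_congr_ae ?_
    filter_upwards [hff, hff'] with x h1 h2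
    rw [h1, h2]
  rw [e₁, e₂]
  exact key

end Main

theorem mainTheorem1 (N : ℕ) (hN : 1 ≤ N) (s : ℝ) (hs0 : 0 < s) (hs1 : s ≤ 1)
    (b : ℝ → ℝ) (hbLip : ∃ K : NNReal, LipschitzWith K b) (hbMono : Monotone b) (hb0 : b 0 = 0)
    (hbGrowth : ∃ lam : ℝ, 0 < lam ∧ ∀ t : ℝ, lam * |t| ^ 2 ≤ b t * t)
    (F : ℝ → EuclideanSpace ℝ (Fin N)) (hFLip : LocallyLipschitz F) (hF0 : F 0 = 0)
    (f f' : EuclideanSpace ℝ (Fin N) → ℝ)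
    (hf1 : MemLp f 1 volume) (hfTop : MemLp f ⊤ volume)
    (hf1' : MemLp f' 1 volume) (hfTop' : MemLp f' ⊤ volume)
    (u u' : EuclideanSpace ℝ (Fin N) → ℝ)
    (hu : IsEntropySolution s b F f u) (hu' : IsEntropySolution s b F f' u')
    (hbu : MemLp (fun x => b (u x)) 1 volume) (hbu' : MemLp (fun x => b (u' x)) 1 volume) :
    (∫ x, |b (u x) - b (u' x)|) ≤ (∫ x, |f x - f' x|) ∧
    (∫ x, max (b (u x) - b (u' x)) 0) ≤ (∫ x, max (f x - f' x) 0) ∧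
    (∫ x, max (-(b (u x) - b (u' x))) 0) ≤ (∫ x, max (-(f x - f' x)) 0) ∧
    ((∀ᵐ x, f x = f' x) → ∀ᵐ x, b (u x) = b (u' x)) ∧
    (StrictMono b → (∀ᵐ x, f x = f' x) → ∀ᵐ x, u x = u' x) := by
  rw [memLp_one_iff_integrable] at hf1 hf1' hbu hbu'
  have hb : Continuous b := hbLip.choose_spec.continuous
  have hpos := hu.integral_posPart_le hN hs0 hs1 hb hbMono hbGrowth hFLip hu' hf1 hf1' hbu hbu'
  -- The negative part is the positive part with the two solutions exchanged.
  have hneg := hu'.integral_posPart_le hN hs0 hs1 hb hbMono hbGrowth hFLip hu hf1' hf1 hbu' hbu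
  have hsplit : ∀ {g g' : EuclideanSpace ℝ (Fin N) → ℝ}, Integrable g → Integrable g' →
      ∫ x, |g x - g' x| = (∫ x, max (g x - g' x) 0) + ∫ x, max (g' x - g x) 0 := by
    intro g g' hg hg'
    have h1 : Integrable fun x => max (g x - g' x) 0 := (hg.sub hg').pos_part
    have h2 : Integrable fun x => max (g' x - g x) 0 := (hg'.sub hg).pos_part
    rw [← integral_add h1 h2]
    refine integral_congr_ae (Eventually.of_forall fun x => ?_)
    simp only
    rcases le_total (g x) (g' x) with hx | hx
    · rw [abs_of_nonpos (by linarith), max_eq_right (by linarith), max_eq_left (by linarith)]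
      ring
    · rw [abs_of_nonneg (by linarith), max_eq_left (by linarith), max_eq_right (by linarith)]
      ring
  have habs : (∫ x, |b (u x) - b (u' x)|) ≤ ∫ x, |f x - f' x| := by
    rw [hsplit hbu hbu', hsplit hf1 hf1']
    exact add_le_add hpos hneg
  have huniq : (∀ᵐ x, f x = f' x) → ∀ᵐ x, b (u x) = b (u' x) := by
    intro hff
    have h0 : ∫ x, |f x - f' x| = 0 := by
      refine integral_eq_zero_of_ae ?_
      filter_upwards [hff] with x hx
      simp [hx]
    have h1 : ∫ x, |b (u x) - b (u' x)| = 0 :=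
      le_antisymm (habs.trans h0.le) (integral_nonneg fun x => abs_nonneg _)
    have h2 := (integral_eq_zero_iff_of_nonneg (fun x => abs_nonneg _) (hbu.sub hbu').abs).1 h1
    filter_upwards [h2] with x hx
    exact sub_eq_zero.1 (abs_eq_zero.1 hx)
  refine ⟨habs, hpos, ?_, huniq, fun hstrict hff => ?_⟩
  · simpa only [neg_sub] using hneg
  · filter_upwards [huniq hff] with x hx
    exact hstrict.injective hx
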